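/- Let $k$ be a commutative ring, $\lambda\in k$, and $X$ a set. An $X$-decorated Motzkin path is a lattice path in $\mathbb N^2$ from $(0,0)$ to some $(n,0)$ with up steps $(1,1)$, down steps $(1,-1)$ and level steps $(1,0)$, each level step being decorated by an element of $X$. Let $\circ$ be the link product (joining two paths end to end), with the trivial path $\bullet$ as identity, let $\lfloor m\rfloor$ be the path obtained from $m$ by adding an up step at the beginning and a down step at the end, and for $x\in X$ let $j_X(x)$ be the path consisting of one level step decorated by $x$. A path is indecomposable if it touches the $x$-axis only at its two ends; valley-free if no down step is followed immediately by an up step; peak-free if it is not $\bullet$ and no up step is followed immediately by a down step. Let $V(X)$ and $L(X)$ be the sets of valley-free and of peak-free $X$-decorated Motzkin paths, and write $kY$ for the free $k$-module on a set $Y$. Extend $\circ$ bilinearly and $\lfloor\ \rfloor$ linearly. A Rota–Baxter algebra of weight $\lambda$ is an associative unitary $k$-algebra $R$ with a $k$-linear operator $P$ such that $P(x)P(y)=P(xP(y))+P(P(x)y)+\lambda P(xy)$ for all $x,y\in R$; a nonunitary one is the same without requiring an identity. Homomorphisms are the algebra homomorphisms (preserving the identity in the unitary case) that commute with the operators. A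 (nonunitary) Rota–Baxter algebra $A$ of weight $\lambda$ with a map $j:X\to A$ is free on $X$ if for every (nonunitary) Rota–Baxter algebra $R$ of weight $\lambda$ and every map $f:X\to R$ there is a unique homomorphism $\bar f:A\to R$ of such algebras with $\bar f\circ j=f$. There is a unique $k$-bilinear product $\diamond_v$ on $kV(X)$ with the following properties. 1. The trivial path $\bullet$ is an identity for $\diamond_v$. 2. Let $m,m'\in V(X)$ be indecomposable and different from $\bullet$. If $m$ or $m'$ is a single level step, then $m\diamond_v m'=m\circ m'$. If $m=\lfloor n\rfloor$ and $m'=\lfloor n'\rfloor$, then $m\diamond_v m'=\lfloor n\diamond_v m'\rfloor+\lfloor m\diamond_v n'\rfloor+\lambda\lfloor n\diamond_v n'\rfloor$. 3. If $m=m_1\circ\cdots\circ m_p$ and $m'=m'_1\circ\cdots\circ m'_q$ ($p,q\ge 1$) are the decompositions of $m,m'\in V(X)\setminus\{\bullet\}$ into indecomposable paths different from $\bullet$, then $m\diamond_v m'=m_1\circ\cdots\circ m_{p-1}\circ(m_p\diamond_v m'_1)\circ m'_2\circ\cdots\circ m'_q$. With this product, $(kV(X),\diamond_v,\lfloor\ \rfloor,j_X)$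 is the free Rota–Baxter algebra of weight $\lambda$ on $X$. Moreover, $k(V(X)\cap L(X))\subseteq kV(X)$ is closed under $\diamond_v$ and $\lfloor\ \rfloor$, and $(k(V(X)\cap L(X)),\diamond_v,\lfloor\ \rfloor,j_X)$ is the free nonunitary Rota–Baxter algebra of weight $\lambda$ on $X$. -/

import Mathlib

universe u v w t

/-! # Decorated Motzkin paths and free Rota-Baxter algebras -/

/-- The steps of an `X`-decorated Motzkin path: up steps `(1, 1)`, down steps `(1, -1)` and
level steps `(1, 0)`, the latter decorated by an element of `X`. -/
inductive MotzkinStep (X : Type v) : Type v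
  | up : MotzkinStep X
  | down : MotzkinStep X
  | level (x : X) : MotzkinStep X

/-- The vertical displacement of a step. -/
def MotzkinStep.rise {X : Type v} : MotzkinStep X → ℤ
  | .up => 1
  | .down => -1
  | .level _ => 0

/-- The height at which a sequence of steps starting on the `x`-axis ends. -/
def stepHeight {X : Type v} (l : List (MotzkinStep X)) : ℤ := (l.map MotzkinStep.rise).sum

@[simp] theorem stepHeight_nil {X : Type v} : stepHeight ([] : List (MotzkinStep X)) = 0 := rfl

@[simp] theorem stepHeight_cons {X : Type v} (s : MotzkinStep X) (l : List (MotzkinStep X)) :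
    stepHeight (s :: l) = s.rise + stepHeight l := by simp [stepHeight]

@[simp] theorem stepHeight_append {X : Type v} (l l' : List (MotzkinStep X)) :
    stepHeight (l ++ l') = stepHeight l + stepHeight l' := by simp [stepHeight]

/-- An `X`-decorated Motzkin path: a lattice path that starts and ends on the `x`-axis and never
goes below it, given by the sequence of its steps. -/
@[ext] structure MotzkinPath (X : Type v) : Type v where
  steps : List (MotzkinStep X)
  nonneg : ∀ l, l <+: steps → 0 ≤ stepHeight l
  height_eq : stepHeight steps = 0

theorem prefix_append_cases {α : Type v} {l a b : List α} (h : l <+: a ++ b) :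
    l <+: a ∨ ∃ t, l = a ++ t ∧ t <+: b := by
  obtain ⟨r, hr⟩ := h
  rcases List.append_eq_append_iff.1 hr with ⟨t, rfl, rfl⟩ | ⟨t, rfl, rfl⟩
  · exact Or.inl ⟨t, rfl⟩
  · exact Or.inr ⟨t, rfl, ⟨r, rfl⟩⟩

namespace MotzkinPath

variable {X : Type v}

/-- The trivial path. -/
instance : One (MotzkinPath X) :=
  ⟨⟨[], by intro l hl; simp [List.prefix_nil.1 hl], rfl⟩⟩

/-- The link product: the two paths are joined end to end. -/
instance : Mul (MotzkinPath X) :=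
  ⟨fun m n => ⟨m.steps ++ n.steps, by
    intro l hl
    rcases prefix_append_cases hl with h | ⟨t, rfl, h⟩
    · exact m.nonneg l h
    · simpa [m.height_eq] using n.nonneg t h, by simp [m.height_eq, n.height_eq]⟩⟩

@[simp] theorem steps_one : (1 : MotzkinPath X).steps = [] := rfl

@[simp] theorem steps_mul (m n : MotzkinPath X) : (m * n).steps = m.steps ++ n.steps := rfl

/-- Paths form a monoid under the link product. -/
instance : Monoid (MotzkinPath X) where
  mul_assoc a b c := by ext1; simp
  one_mul a := by ext1; simp
  mul_one a := by ext1; simp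

/-- The path consisting of a single level step decorated by `x`. -/
def level (x : X) : MotzkinPath X :=
  ⟨[.level x], by
    intro l hl
    rcases List.prefix_cons_iff.1 hl with rfl | ⟨t, rfl, h⟩
    · simp
    · simp [List.prefix_nil.1 h, MotzkinStep.rise], by simp [MotzkinStep.rise]⟩

/-- The raising operator: an up step is put before the path and a down step after it. -/
def raise (m : MotzkinPath X) : MotzkinPath X :=
  ⟨.up :: (m.steps ++ [.down]), by
    intro l hl
    rcases List.prefix_cons_iff.1 hl with rfl | ⟨t, rfl, h⟩
    · simp
    · rcases prefix_append_cases h with h | ⟨t', rfl, h'⟩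
      · have := m.nonneg t h
        simp [MotzkinStep.rise]; omega
      · rcases List.prefix_cons_iff.1 h' with rfl | ⟨t, rfl, h''⟩
        · simp [MotzkinStep.rise, m.height_eq]
        · simp [List.prefix_nil.1 h'', MotzkinStep.rise, m.height_eq],
    by simp [MotzkinStep.rise, m.height_eq]⟩

@[simp] theorem steps_level (x : X) : (level x).steps = [.level x] := rfl

@[simp] theorem steps_raise (m : MotzkinPath X) :
    m.raise.steps = .up :: (m.steps ++ [.down]) := rfl

/-- A path is indecomposable if it touches the `x`-axis only at its two ends. -/
def Indecomposable (m : MotzkinPath X) : Prop :=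
  ∀ n, 0 < n → n < m.steps.length → stepHeight (m.steps.take n) ≠ 0

/-- No down step is followed immediately by an up step. -/
def ValleyFree (m : MotzkinPath X) : Prop :=
  m.steps.IsChain fun s t => ¬ (s = .down ∧ t = .up)

/-- The path is not trivial, and no up step is followed immediately by a down step. -/
def PeakFree (m : MotzkinPath X) : Prop :=
  m ≠ 1 ∧ m.steps.IsChain fun s t => ¬ (s = .up ∧ t = .down)

/-- The first step is an up step. -/
def StartsUp (m : MotzkinPath X) : Prop := m.steps.head? = some .up

/-- The last step is a down step. -/
def EndsDown (m : MotzkinPath X) : Prop := m.steps.getLast? = some .down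

/-! ### Splitting off the first and the last indecomposable factor -/

theorem exists_first_return (t : List (MotzkinStep X)) : ∀ c : ℤ, 0 ≤ c → c + stepHeight t < 0 →
    ∃ p q, t = p ++ .down :: q ∧ (∀ r, r <+: p → 0 ≤ c + stepHeight r) ∧ c + stepHeight p = 0 := by
  induction t with
  | nil => intro c hc h; simp at h; omega
  | cons s t ih =>
    intro c hc h
    by_cases hs : 0 ≤ c + s.rise
    · obtain ⟨p, q, rfl, h1, h2⟩ := ih (c + s.rise) hs (by simp at h; omega)
      refine ⟨s :: p, q, rfl, ?_, by simp; omega⟩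
      intro r hr
      rcases List.prefix_cons_iff.1 hr with rfl | ⟨r', rfl, hr'⟩
      · simpa using hc
      · have := h1 r' hr'
        simp; omega
    · cases s with
      | up => simp [MotzkinStep.rise] at hs; omega
      | level x => simp [MotzkinStep.rise] at hs; omega
      | down =>
        simp only [MotzkinStep.rise] at hs
        refine ⟨[], t, rfl, ?_, by simp; omega⟩
        intro r hr
        simp [List.prefix_nil.1 hr, hc]

theorem exists_raise_mul (m : MotzkinPath X) (h : m.StartsUp) :
    ∃ n b : MotzkinPath X, m = n.raise * b := by
  obtain ⟨l, hl, h0⟩ := m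
  cases l with
  | nil => simp [StartsUp] at h
  | cons s t =>
    simp only [StartsUp, List.head?_cons, Option.some.injEq] at h
    subst h
    obtain ⟨p, q, rfl, h1, h2⟩ := exists_first_return t 0 le_rfl (by
      simp [MotzkinStep.rise] at h0; omega)
    refine ⟨⟨p, by simpa using h1, by simpa using h2⟩, ⟨q, ?_, ?_⟩, ?_⟩
    · intro r hr
      have := hl (.up :: (p ++ .down :: r)) (by simpa using hr)
      simp [MotzkinStep.rise] at this h2
      omega
    · simp [MotzkinStep.rise] at h0 h2; omega
    · ext1; simp

theorem exists_mul_raise (m : MotzkinPath X) (h : m.EndsDown) :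
    ∃ a n : MotzkinPath X, m = a * n.raise := by
  induction hk : m.steps.length using Nat.strong_induction_on generalizing m with
  | _ k ih =>
    have key : ∀ a b : MotzkinPath X, m = a * b → a ≠ 1 → b ≠ 1 →
        ∃ a n : MotzkinPath X, m = a * n.raise := by
      rintro a b rfl ha hb
      have ha' : a.steps ≠ [] := fun h => ha (MotzkinPath.ext h)
      have hb' : b.steps ≠ [] := fun h => hb (MotzkinPath.ext h)
      obtain ⟨a', n, hn⟩ := ih b.steps.length (by
        have := List.length_pos_iff.2 ha'
        simp at hk; omega) b (by
          simp only [EndsDown, steps_mul, List.getLast?_append] at h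
          rw [List.getLast?_eq_some_getLast hb'] at h
          simpa [EndsDown, List.getLast?_eq_some_getLast hb'] using h) rfl
      exact ⟨a * a', n, by rw [hn, mul_assoc]⟩
    obtain ⟨l, hl, h0⟩ := m
    cases l with
    | nil => simp [EndsDown] at h
    | cons s t =>
      cases s with
      | down =>
        have := hl [.down] (by simp)
        simp [MotzkinStep.rise] at this
      | up =>
        obtain ⟨n, b, hb⟩ := exists_raise_mul ⟨.up :: t, hl, h0⟩ rfl
        by_cases hb1 : b = 1
        · exact ⟨1, n, by rw [hb, hb1]; simp⟩
        · exact key _ b hb (fun h => by simpa using congrArg steps h) hb1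
      | level x =>
        have e : (⟨.level x :: t, hl, h0⟩ : MotzkinPath X) = level x * ⟨t, fun r hr => by
            have := hl (.level x :: r) (by simpa using hr)
            simpa [MotzkinStep.rise] using this, by simpa [MotzkinStep.rise] using h0⟩ := by
          ext1; simp
        refine key _ _ e (fun h => by simpa using congrArg steps h) ?_
        intro h1
        have ht : t = [] := congrArg steps h1
        subst ht
        simp [EndsDown] at h

theorem ValleyFree.of_mul_left {a b : MotzkinPath X} (h : (a * b).ValleyFree) : a.ValleyFree :=
  (List.isChain_append.1 h).1

theorem ValleyFree.of_mul_right {a b : MotzkinPath X} (h : (a * b).ValleyFree) : b.ValleyFree :=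
  (List.isChain_append.1 h).2.1

theorem ValleyFree.not_endsDown_and_startsUp {a b : MotzkinPath X} (h : (a * b).ValleyFree) :
    ¬ (a.EndsDown ∧ b.StartsUp) := fun hab =>
  (List.isChain_append.1 h).2.2 _ hab.1 _ hab.2 ⟨rfl, rfl⟩

theorem ValleyFree.mul {a b : MotzkinPath X} (ha : a.ValleyFree) (hb : b.ValleyFree)
    (h : ¬ (a.EndsDown ∧ b.StartsUp)) : (a * b).ValleyFree := by
  refine List.isChain_append.2 ⟨ha, hb, ?_⟩
  rintro s hs t ht ⟨rfl, rfl⟩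
  exact h ⟨hs, ht⟩

theorem startsUp_raise_mul (n b : MotzkinPath X) : (n.raise * b).StartsUp := rfl

theorem endsDown_mul_raise (a n : MotzkinPath X) : (a * n.raise).EndsDown := by
  change (a.steps ++ MotzkinStep.up :: (n.steps ++ [MotzkinStep.down])).getLast? = _
  rw [← List.cons_append, ← List.append_assoc, List.getLast?_concat]

theorem ValleyFree.raise {m : MotzkinPath X} (h : m.ValleyFree) : m.raise.ValleyFree := by
  refine List.isChain_cons.2 ⟨by simp, List.isChain_append.2 ⟨h, by simp, by simp⟩⟩

theorem ValleyFree.of_raise {m : MotzkinPath X} (h : m.raise.ValleyFree) : m.ValleyFree :=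
  (List.isChain_append.1 (List.isChain_cons.1 h).2).1

theorem PeakFree.raise {m : MotzkinPath X} (h : m.PeakFree) : m.raise.PeakFree := by
  refine ⟨fun h => by simpa using congrArg steps h, ?_⟩
  have hne : m.steps ≠ [] := fun h' => h.1 (MotzkinPath.ext h')
  obtain ⟨s, l, hs⟩ := List.exists_cons_of_ne_nil hne
  obtain ⟨l', s', hs'⟩ := List.eq_nil_or_concat m.steps |>.resolve_left hne
  refine List.isChain_cons.2 ⟨?_, List.isChain_append.2 ⟨h.2, by simp, ?_⟩⟩
  · rw [hs]
    rintro y hy ⟨-, rfl⟩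
    have e : s = .down := by simpa using hy
    subst e
    have := m.nonneg [.down] (by rw [hs]; simp)
    simp [MotzkinStep.rise] at this
  · rw [hs']
    rintro y hy z - ⟨rfl, -⟩
    have e : s' = .up := by simpa using hy
    subst e
    have h1 := m.nonneg l' (by rw [hs']; simp)
    have h2 := m.height_eq
    rw [hs'] at h2
    simp [MotzkinStep.rise] at h2
    omega

theorem valleyFree_level (x : X) : (level x).ValleyFree := List.isChain_singleton _

theorem peakFree_level (x : X) : (level x).PeakFree :=
  ⟨fun h => by simpa using congrArg steps h, List.isChain_singleton _⟩

end MotzkinPath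

/-- The set of valley-free `X`-decorated Motzkin paths. -/
abbrev ValleyFreePath (X : Type v) : Type v := {m : MotzkinPath X // m.ValleyFree}

/-- The set of `X`-decorated Motzkin paths that are both valley-free and peak-free. -/
abbrev ValleyPeakFreePath (X : Type v) : Type v :=
  {m : MotzkinPath X // m.ValleyFree ∧ m.PeakFree}

namespace ValleyFreePath

variable {X : Type v}

/-- The trivial path is valley-free. -/
def trivialPath : ValleyFreePath X := ⟨1, List.isChain_nil⟩

/-- A single decorated level step, as a valley-free path. -/
def level (x : X) : ValleyFreePath X := ⟨MotzkinPath.level x, MotzkinPath.valleyFree_level x⟩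

/-- The raising operator on valley-free paths. -/
def raise (m : ValleyFreePath X) : ValleyFreePath X := ⟨m.1.raise, m.2.raise⟩

theorem exists_last (m : ValleyFreePath X) (h : m.1.EndsDown) :
    ∃ p : ValleyFreePath X × ValleyFreePath X, m.1 = p.1.1 * p.2.1.raise := by
  obtain ⟨a, n, e⟩ := m.1.exists_mul_raise h
  have hm := m.2
  rw [e] at hm
  exact ⟨(⟨a, hm.of_mul_left⟩, ⟨n, hm.of_mul_right.of_raise⟩), e⟩

theorem exists_first (m : ValleyFreePath X) (h : m.1.StartsUp) :
    ∃ p : ValleyFreePath X × ValleyFreePath X, m.1 = p.1.1.raise * p.2.1 := by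
  obtain ⟨n, b, e⟩ := m.1.exists_raise_mul h
  have hm := m.2
  rw [e] at hm
  exact ⟨(⟨n, hm.of_mul_left.of_raise⟩, ⟨b, hm.of_mul_right⟩), e⟩

/-- If the last step of `m` is a down step, then `m = a ∘ ⌊n⌋`; this is `a`. -/
noncomputable def beforeLast (m : ValleyFreePath X) (h : m.1.EndsDown) : ValleyFreePath X :=
  (exists_last m h).choose.1

/-- If the last step of `m` is a down step, then `m = a ∘ ⌊n⌋`; this is `n`. -/
noncomputable def insideLast (m : ValleyFreePath X) (h : m.1.EndsDown) : ValleyFreePath X :=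
  (exists_last m h).choose.2

/-- If the first step of `m` is an up step, then `m = ⌊n⌋ ∘ b`; this is `n`. -/
noncomputable def insideFirst (m : ValleyFreePath X) (h : m.1.StartsUp) : ValleyFreePath X :=
  (exists_first m h).choose.1

/-- If the first step of `m` is an up step, then `m = ⌊n⌋ ∘ b`; this is `b`. -/
noncomputable def afterFirst (m : ValleyFreePath X) (h : m.1.StartsUp) : ValleyFreePath X :=
  (exists_first m h).choose.2

theorem eq_beforeLast_mul (m : ValleyFreePath X) (h : m.1.EndsDown) :
    m.1 = (beforeLast m h).1 * (insideLast m h).1.raise := (exists_last m h).choose_spec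

theorem eq_mul_afterFirst (m : ValleyFreePath X) (h : m.1.StartsUp) :
    m.1 = (insideFirst m h).1.raise * (afterFirst m h).1 := (exists_first m h).choose_spec

theorem not_endsDown_beforeLast (m : ValleyFreePath X) (h : m.1.EndsDown) :
    ¬ (beforeLast m h).1.EndsDown := fun ha =>
  MotzkinPath.ValleyFree.not_endsDown_and_startsUp (eq_beforeLast_mul m h ▸ m.2)
    ⟨ha, by simpa using MotzkinPath.startsUp_raise_mul (insideLast m h).1 1⟩

theorem not_startsUp_afterFirst (m : ValleyFreePath X) (h : m.1.StartsUp) :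
    ¬ (afterFirst m h).1.StartsUp := fun hb =>
  MotzkinPath.ValleyFree.not_endsDown_and_startsUp (eq_mul_afterFirst m h ▸ m.2)
    ⟨by simpa using MotzkinPath.endsDown_mul_raise 1 (insideFirst m h).1, hb⟩

/-- The path `a ∘ ⌊v⌋ ∘ b`, for `a` not ending in a down step and `b` not starting with an up
step. -/
def sandwich (a b : ValleyFreePath X) (ha : ¬ a.1.EndsDown) (hb : ¬ b.1.StartsUp)
    (v : ValleyFreePath X) : ValleyFreePath X :=
  ⟨a.1 * v.1.raise * b.1, (a.2.mul v.2.raise fun h => ha h.1).mul b.2 fun h => hb h.2⟩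

/-- The product of two valley-free paths, an element of the free module on valley-free paths.
If `m` ends in a down step and `m'` starts with an up step, write `m = a ∘ ⌊n⌋` and
`m' = ⌊n'⌋ ∘ b`; then the product is
`a ∘ (⌊n ⋄ ⌊n'⌋⌋ + ⌊⌊n⌋ ⋄ n'⌋ + lam ⌊n ⋄ n'⌋) ∘ b`.
In all other cases (one of the paths is trivial, or the last factor of `m` or the first factor of
`m'` is a level step) it is the link product. -/
noncomputable def diamond {k : Type u} [CommRing k] (lam : k) (m m' : ValleyFreePath X) :
    ValleyFreePath X →₀ k :=
  open Classical in
  if h : m.1.EndsDown ∧ m'.1.StartsUp then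
    let a := beforeLast m h.1
    let n := insideLast m h.1
    let n' := insideFirst m' h.2
    let b := afterFirst m' h.2
    Finsupp.mapDomain
      (sandwich a b (not_endsDown_beforeLast m h.1) (not_startsUp_afterFirst m' h.2))
      (diamond lam n n'.raise + diamond lam n.raise n' + lam • diamond lam n n')
  else Finsupp.single ⟨m.1 * m'.1, m.2.mul m'.2 h⟩ 1
termination_by m.1.steps.length + m'.1.steps.length
decreasing_by
  all_goals
    have e := congrArg (fun r => r.steps.length) (eq_beforeLast_mul m h.1)
    have e' := congrArg (fun r => r.steps.length) (eq_mul_afterFirst m' h.2)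
    simp [raise] at e e' ⊢
    omega

end ValleyFreePath

section Modules

variable {k : Type u} [CommRing k] {X : Type v}

/-- The product on the free module on valley-free paths: the bilinear extension of the product of
two paths. -/
noncomputable def diamondMul (lam : k) :
    (ValleyFreePath X →₀ k) →ₗ[k] (ValleyFreePath X →₀ k) →ₗ[k] (ValleyFreePath X →₀ k) :=
  Finsupp.linearCombination k fun m =>
    Finsupp.linearCombination k fun m' => ValleyFreePath.diamond lam m m'

variable (k X) in
/-- The raising operator on the free module on valley-free paths. -/
noncomputable def raiseOp : (ValleyFreePath X →₀ k) →ₗ[k] (ValleyFreePath X →₀ k) :=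
  Finsupp.lmapDomain k k ValleyFreePath.raise

variable (k) in
/-- The element `x` of `X`, sent to the level step decorated by `x`. -/
noncomputable def levelMap (x : X) : ValleyFreePath X →₀ k :=
  Finsupp.single (ValleyFreePath.level x) 1

variable (k X) in
/-- The inclusion of the free module on valley-free paths into the monoid algebra of all paths,
whose multiplication is the bilinear extension of the link product. -/
noncomputable def toPathAlgebra :
    (ValleyFreePath X →₀ k) →ₗ[k] MonoidAlgebra k (MotzkinPath X) :=
  Finsupp.linearCombination k fun m => MonoidAlgebra.of k (MotzkinPath X) m.1

/-- The properties characterizing the product of valley-free paths. -/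
structure IsDiamondProduct (lam : k)
    (mul : (ValleyFreePath X →₀ k) →ₗ[k] (ValleyFreePath X →₀ k) →ₗ[k] (ValleyFreePath X →₀ k)) :
    Prop where
  /-- The trivial path is the identity. -/
  one_mul : ∀ a, mul (Finsupp.single ValleyFreePath.trivialPath 1) a = a
  mul_one : ∀ a, mul a (Finsupp.single ValleyFreePath.trivialPath 1) = a
  /-- For nontrivial indecomposable paths, one of which is a level step, the product is the link
  product. -/
  level : ∀ m m' : ValleyFreePath X, m.1.Indecomposable → m.1 ≠ 1 → m'.1.Indecomposable →
    m'.1 ≠ 1 → ((∃ x, m = ValleyFreePath.level x) ∨ ∃ x, m' = ValleyFreePath.level x) →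
    toPathAlgebra k X (mul (Finsupp.single m 1) (Finsupp.single m' 1)) =
      MonoidAlgebra.of k _ (m.1 * m'.1)
  /-- The Rota-Baxter recursion on raised paths. -/
  raise_raise : ∀ n n' : ValleyFreePath X,
    mul (Finsupp.single n.raise 1) (Finsupp.single n'.raise 1) =
      raiseOp k X (mul (Finsupp.single n 1) (Finsupp.single n'.raise 1)) +
      raiseOp k X (mul (Finsupp.single n.raise 1) (Finsupp.single n' 1)) +
      lam • raiseOp k X (mul (Finsupp.single n 1) (Finsupp.single n' 1))
  /-- If `m = m₁ ∘ ⋯ ∘ mₚ` and `m' = m'₁ ∘ ⋯ ∘ m'_q` are the decompositions into nontrivial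
  indecomposable paths, then `m ⋄ m' = m₁ ∘ ⋯ ∘ (mₚ ⋄ m'₁) ∘ ⋯ ∘ m'_q`. Here `l` lists the
  factors of `m` before the last factor `n`, and `l'` those of `m'` after the first factor `n'`. -/
  link : ∀ (m m' n n' : ValleyFreePath X) (l l' : List (MotzkinPath X)),
    (∀ p ∈ l, p.Indecomposable ∧ p ≠ 1) → n.1.Indecomposable → n.1 ≠ 1 →
    n'.1.Indecomposable → n'.1 ≠ 1 → (∀ p ∈ l', p.Indecomposable ∧ p ≠ 1) →
    m.1 = l.prod * n.1 → m'.1 = n'.1 * l'.prod →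
    toPathAlgebra k X (mul (Finsupp.single m 1) (Finsupp.single m' 1)) =
      MonoidAlgebra.of k _ l.prod *
        toPathAlgebra k X (mul (Finsupp.single n 1) (Finsupp.single n' 1)) *
        MonoidAlgebra.of k _ l'.prod

variable (k X) in
/-- The inclusion of the free module on valley-free peak-free paths into the free module on
valley-free paths. -/
noncomputable def peakFreeInclusion :
    (ValleyPeakFreePath X →₀ k) →ₗ[k] (ValleyFreePath X →₀ k) :=
  Finsupp.lmapDomain k k fun m => ⟨m.1, m.2.1⟩

variable (k X) in
/-- The raising operator on the free module on valley-free peak-free paths. -/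
noncomputable def peakFreeRaiseOp :
    (ValleyPeakFreePath X →₀ k) →ₗ[k] (ValleyPeakFreePath X →₀ k) :=
  Finsupp.lmapDomain k k fun m => ⟨m.1.raise, m.2.1.raise, m.2.2.raise⟩

variable (k) in
/-- The element `x` of `X`, sent to the level step decorated by `x`. -/
noncomputable def peakFreeLevelMap (x : X) : ValleyPeakFreePath X →₀ k :=
  Finsupp.single
    ⟨MotzkinPath.level x, MotzkinPath.valleyFree_level x, MotzkinPath.peakFree_level x⟩ 1

end Modules

section RotaBaxter

variable {k : Type u} [CommRing k]

/-- `(R, P)` is a Rota-Baxter algebra of weight `lam`, unitary or not. -/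
def IsRotaBaxterOperator {R : Type w} [NonUnitalRing R] [Module k R] (lam : k)
    (P : R →ₗ[k] R) : Prop :=
  ∀ x y, P x * P y = P (x * P y) + P (P x * y) + lam • P (x * y)

/-- A `k`-module `A` with bilinear product `mul` and linear operator `P` is a nonunitary
Rota-Baxter algebra of weight `lam`: the product is associative, and `P` satisfies the Rota-Baxter
identity. -/
structure IsNonunitaryRotaBaxterAlgebra {A : Type t} [AddCommGroup A] [Module k A] (lam : k)
    (mul : A →ₗ[k] A →ₗ[k] A) (P : A →ₗ[k] A) : Prop where
  assoc : ∀ a b c, mul (mul a b) c = mul a (mul b c)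
  rotaBaxter : ∀ a b, mul (P a) (P b) = P (mul a (P b)) + P (mul (P a) b) + lam • P (mul a b)

/-- The same, for a unitary algebra with identity `one`. -/
structure IsRotaBaxterAlgebra {A : Type t} [AddCommGroup A] [Module k A] (lam : k)
    (mul : A →ₗ[k] A →ₗ[k] A) (one : A) (P : A →ₗ[k] A) : Prop
    extends IsNonunitaryRotaBaxterAlgebra lam mul P where
  one_mul : ∀ a, mul one a = a
  mul_one : ∀ a, mul a one = a

/-- `(A, mul, one, P, j)` is the free (unitary) Rota-Baxter algebra of weight `lam` on `X`: it is a
Rota-Baxter algebra, and every map from `X` to a Rota-Baxter algebra `(R, Q)` of weight `lam`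
factors through `j` by a unique homomorphism of (unitary) Rota-Baxter algebras. -/
structure IsFreeRotaBaxterAlgebra {A : Type t} [AddCommGroup A] [Module k A] (lam : k)
    (mul : A →ₗ[k] A →ₗ[k] A) (one : A) (P : A →ₗ[k] A) {X : Type v} (j : X → A) : Prop where
  isRotaBaxterAlgebra : IsRotaBaxterAlgebra lam mul one P
  existsUnique_lift : ∀ (R : Type w) [Ring R] [Algebra k R] (Q : R →ₗ[k] R),
    IsRotaBaxterOperator lam Q → ∀ f : X → R, ∃! φ : A →ₗ[k] R,
      φ one = 1 ∧ (∀ a b, φ (mul a b) = φ a * φ b) ∧ (∀ a, φ (P a) = Q (φ a)) ∧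
      ∀ x, φ (j x) = f x

/-- `(A, mul, P, j)` is the free nonunitary Rota-Baxter algebra of weight `lam` on `X`. -/
structure IsFreeNonunitaryRotaBaxterAlgebra {A : Type t} [AddCommGroup A] [Module k A] (lam : k)
    (mul : A →ₗ[k] A →ₗ[k] A) (P : A →ₗ[k] A) {X : Type v} (j : X → A) : Prop where
  isNonunitaryRotaBaxterAlgebra : IsNonunitaryRotaBaxterAlgebra lam mul P
  existsUnique_lift : ∀ (R : Type w) [NonUnitalRing R] [Module k R] [IsScalarTower k R R]
    [SMulCommClass k R R] (Q : R →ₗ[k] R),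
    IsRotaBaxterOperator lam Q → ∀ f : X → R, ∃! φ : A →ₗ[k] R,
      (∀ a b, φ (mul a b) = φ a * φ b) ∧ (∀ a, φ (P a) = Q (φ a)) ∧ ∀ x, φ (j x) = f x

end RotaBaxter

/-!
The recursion defining `⋄` on valley-free paths makes sense on all Motzkin paths, valleys allowed:
`a⌊n⌋ ⋄ ⌊n'⌋b = a (⌊n ⋄ ⌊n'⌋⌋ + ⌊⌊n⌋ ⋄ n'⌋ + lam ⌊n ⋄ n'⌋) b`, and `m ⋄ m' = m m'` if no valley
arises where the paths meet (`MotzkinPath.diamond`). It is well defined because the last raised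
factor and the first raised factor of a path are unique (`mul_raise_inj`, `raise_mul_inj`). On the
algebra of all paths both products live on the same module, and `⋄` commutes with linking on the
outer sides (`diamondLinear_mul_of`, `diamondLinear_of_mul`). Hence associativity is immediate when
the middle path is a link product or a level step, or when one of the outer paths does not meet the
middle one in a valley; the only remaining case is that of three raised paths, where both sides are
expanded with the Rota-Baxter identity and the claim follows by induction on the number of steps
(`diamondLinear_assoc_raise`). The valley-free paths span a submodule closed under `⋄`
(`toPathAlgebra_diamondMul`), which therefore inherits associativity and the Rota-Baxter identity.

For freeness, a path is evaluated in an algebra `R` with an operator `Q` by reading level steps as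
given elements, link products as products and raising as `Q` (`evalHom`). Evaluation respects `⋄` as
soon as `Q` satisfies the Rota-Baxter identity on the values that occur (`evalAlgHom_diamond`). A
homomorphism is determined by its values on level steps because a valley-free path is a
`⋄`-product, in fact a link product, of its indecomposable factors. In the nonunitary case the
evaluation takes place in the unitization of `R`; the extension of `Q` by zero is not a Rota-Baxter
operator there, but only scalar-free elements occur inside raised factors of peak-free paths.
-/

/-! ### Decompositions of Motzkin paths -/

namespace MotzkinPath

variable {X : Type v}

theorem raise_mul_ne_one (n b : MotzkinPath X) : n.raise * b ≠ 1 := fun h => by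
  simpa using congrArg steps h

theorem raise_ne_one (n : MotzkinPath X) : n.raise ≠ 1 := fun h => by
  simpa using congrArg steps h

theorem level_ne_one (x : X) : level x ≠ 1 := fun h => by
  simpa using congrArg steps h

theorem steps_ne_nil {m : MotzkinPath X} (h : m ≠ 1) : m.steps ≠ [] := fun h' =>
  h (MotzkinPath.ext h')

theorem mul_eq_one {a b : MotzkinPath X} : a * b = 1 ↔ a = 1 ∧ b = 1 := by
  simp [MotzkinPath.ext_iff]

theorem not_startsUp_one : ¬ (1 : MotzkinPath X).StartsUp := by simp [StartsUp]

theorem not_endsDown_one : ¬ (1 : MotzkinPath X).EndsDown := by simp [EndsDown]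

theorem not_startsUp_level (x : X) : ¬ (level x).StartsUp := by simp [StartsUp]

theorem not_endsDown_level (x : X) : ¬ (level x).EndsDown := by simp [EndsDown]

theorem endsDown_mul {a c : MotzkinPath X} (hc : c ≠ 1) : (a * c).EndsDown ↔ c.EndsDown := by
  simp [EndsDown, List.getLast?_append, List.getLast?_eq_some_getLast (steps_ne_nil hc)]

theorem startsUp_mul {a b : MotzkinPath X} (ha : a ≠ 1) : (a * b).StartsUp ↔ a.StartsUp := by
  simp [StartsUp, List.head?_append, List.head?_eq_some_head (steps_ne_nil ha)]

theorem getLast?_ne_up (m : MotzkinPath X) : m.steps.getLast? ≠ some .up := by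
  intro h
  obtain ⟨l, hl⟩ := List.getLast?_eq_some_iff.1 h
  have h1 := m.nonneg l (by rw [hl]; simp)
  have h2 := m.height_eq
  rw [hl] at h2
  simp [MotzkinStep.rise] at h2
  omega

theorem eq_one_or_level_mul_or_startsUp (m : MotzkinPath X) :
    m = 1 ∨ (∃ x r, m = level x * r) ∨ m.StartsUp := by
  obtain ⟨l, hl, h0⟩ := m
  rcases l with _ | ⟨s | _ | x, l⟩
  · exact Or.inl rfl
  · exact Or.inr (Or.inr rfl)
  · have := hl [.down] (by simp)
    simp [MotzkinStep.rise] at this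
  · refine Or.inr (Or.inl ⟨x, ⟨l, fun r hr => ?_, ?_⟩, ?_⟩)
    · have := hl (.level x :: r) (by simpa using hr)
      simpa [MotzkinStep.rise] using this
    · simpa [MotzkinStep.rise] using h0
    · ext1; simp

/-- Every path is built from the trivial path by putting a level step or a raised path in front. -/
@[elab_as_elim]
theorem factor_induction {motive : MotzkinPath X → Prop} (m : MotzkinPath X) (one : motive 1)
    (level_mul : ∀ x r, motive r → motive (level x * r))
    (raise_mul : ∀ n r, motive n → motive r → motive (n.raise * r)) : motive m := by
  induction hk : m.steps.length using Nat.strong_induction_on generalizing m with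
  | _ k ih =>
    subst hk
    rcases m.eq_one_or_level_mul_or_startsUp with rfl | ⟨x, r, rfl⟩ | h
    · exact one
    · exact level_mul x r (ih _ (by simp) r rfl)
    · obtain ⟨n, r, rfl⟩ := m.exists_raise_mul h
      exact raise_mul n r (ih _ (by simp) n rfl) (ih _ (by simp; omega) r rfl)

/-- The first return to the `x`-axis is determined by the path: the parts before it cannot be
proper prefixes of one another, as the longer one would go below the axis. -/
theorem raise_mul_inj {n b n' b' : MotzkinPath X} (h : n.raise * b = n'.raise * b') :
    n = n' ∧ b = b' := by
  have key : ∀ (p p' : MotzkinPath X) (q q' t : List (MotzkinStep X)),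
      p'.steps = p.steps ++ t → MotzkinStep.down :: q = t ++ .down :: q' → t = [] := by
    intro p p' q q' t h1 h2
    rcases t with _ | ⟨s, t⟩
    · rfl
    · obtain ⟨rfl, -⟩ := List.cons.inj h2
      have := p'.nonneg (p.steps ++ [.down]) (by rw [h1]; simp)
      simp [MotzkinStep.rise, p.height_eq] at this
  have e : n.steps ++ .down :: b.steps = n'.steps ++ .down :: b'.steps := by
    simpa using congrArg steps h
  rcases List.append_eq_append_iff.1 e with ⟨t, h1, h2⟩ | ⟨t, h1, h2⟩
  · obtain rfl := key n n' _ _ t h1 h2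
    exact ⟨MotzkinPath.ext (by simpa using h1.symm), MotzkinPath.ext (by simpa using h2)⟩
  · obtain rfl := key n' n _ _ t h1 h2
    exact ⟨MotzkinPath.ext (by simpa using h1), MotzkinPath.ext (by simpa using h2.symm)⟩

/-- The last raised factor is determined by the path, since the path cannot be at height `-1`
inside it. -/
theorem mul_raise_inj {a n a' n' : MotzkinPath X} (h : a * n.raise = a' * n'.raise) :
    a = a' ∧ n = n' := by
  have key : ∀ (p p' : MotzkinPath X) (q q' : MotzkinPath X) (t : List (MotzkinStep X)),
      p'.steps = p.steps ++ t → MotzkinStep.up :: q.steps = t ++ .up :: q'.steps → t = [] := by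
    intro p p' q q' t h1 h2
    rcases t with _ | ⟨s, t⟩
    · rfl
    · obtain ⟨rfl, h3⟩ := List.cons.inj h2
      have h4 := p'.height_eq
      have h5 := q.nonneg t (by rw [h3]; simp)
      simp [h1, MotzkinStep.rise, p.height_eq] at h4
      omega
  have e : a.steps ++ .up :: n.steps = a'.steps ++ .up :: n'.steps := by
    have := congrArg steps h
    simp only [steps_mul, steps_raise, ← List.cons_append, ← List.append_assoc] at this
    exact List.append_cancel_right this
  rcases List.append_eq_append_iff.1 e with ⟨t, h1, h2⟩ | ⟨t, h1, h2⟩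
  · obtain rfl := key a a' _ _ t h1 h2
    exact ⟨MotzkinPath.ext (by simpa using h1.symm), MotzkinPath.ext (by simpa using h2)⟩
  · obtain rfl := key a' a _ _ t h1 h2
    exact ⟨MotzkinPath.ext (by simpa using h1), MotzkinPath.ext (by simpa using h2.symm)⟩

theorem indecomposable_level (x : X) : (level x).Indecomposable := by
  intro n h0 h1
  simp at h1
  omega

theorem indecomposable_raise (n : MotzkinPath X) : n.raise.Indecomposable := by
  intro i h0 h1
  obtain ⟨i, rfl⟩ : ∃ j, i = j + 1 := ⟨i - 1, by omega⟩
  have h2 : i ≤ n.steps.length := by simp at h1; omega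
  have := n.nonneg (n.steps.take i) (List.take_prefix _ _)
  simp [MotzkinStep.rise, List.take_append_of_le_length h2]
  omega

/-- Every path is a product of level steps and raised paths. -/
theorem exists_list_prod (m : MotzkinPath X) :
    ∃ l : List (MotzkinPath X), m = l.prod ∧ ∀ p ∈ l, (∃ x, p = level x) ∨ ∃ n, p = raise n := by
  refine factor_induction m ⟨[], by simp⟩ ?_ ?_
  · rintro x r ⟨l, rfl, h⟩
    exact ⟨level x :: l, by simp, by simpa using h⟩
  · rintro n r - ⟨l, rfl, h⟩
    exact ⟨raise n :: l, by simp, by simpa using h⟩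

theorem indecomposable_and_ne_one {p : MotzkinPath X}
    (h : (∃ x, p = level x) ∨ ∃ n, p = raise n) : p.Indecomposable ∧ p ≠ 1 := by
  rcases h with ⟨x, rfl⟩ | ⟨n, rfl⟩
  · exact ⟨indecomposable_level x, level_ne_one x⟩
  · exact ⟨indecomposable_raise n, raise_ne_one n⟩

/-! ### Paths without peaks -/

/-- No up step is followed immediately by a down step. Unlike for `PeakFree`, the path may be
trivial, so that the property passes to all factors. -/
def NoPeak (m : MotzkinPath X) : Prop :=
  m.steps.IsChain fun s t => ¬ (s = .up ∧ t = .down)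

theorem NoPeak.of_mul_left {a b : MotzkinPath X} (h : (a * b).NoPeak) : a.NoPeak :=
  (List.isChain_append.1 h).1

theorem NoPeak.of_mul_right {a b : MotzkinPath X} (h : (a * b).NoPeak) : b.NoPeak :=
  (List.isChain_append.1 h).2.1

theorem NoPeak.mul {a b : MotzkinPath X} (ha : a.NoPeak) (hb : b.NoPeak) : (a * b).NoPeak := by
  refine List.isChain_append.2 ⟨ha, hb, ?_⟩
  rintro s hs t - ⟨rfl, -⟩
  exact getLast?_ne_up a hs

theorem NoPeak.peakFree_of_raise {m : MotzkinPath X} (h : m.raise.NoPeak) : m.PeakFree := by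
  refine ⟨?_, (List.isChain_append.1 (List.isChain_cons.1 h).2).1⟩
  rintro rfl
  simp [NoPeak] at h

theorem PeakFree.noPeak {m : MotzkinPath X} (h : m.PeakFree) : m.NoPeak := h.2

theorem PeakFree.mul {m m' : MotzkinPath X} (hm : m.PeakFree) (hm' : m'.PeakFree) :
    (m * m').PeakFree :=
  ⟨fun h => hm.1 (mul_eq_one.1 h).1, hm.noPeak.mul hm'.noPeak⟩

end MotzkinPath

/-! ### The product of arbitrary paths -/

namespace MotzkinPath

variable {k : Type u} [CommRing k] {X : Type v}

variable (k X) in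
/-- The linear extension of the raising operator to the algebra of all paths. -/
noncomputable def raiseLinear :
    MonoidAlgebra k (MotzkinPath X) →ₗ[k] MonoidAlgebra k (MotzkinPath X) :=
  MonoidAlgebra.mapDomainLinearMap k k raise

@[simp] theorem raiseLinear_of (m : MotzkinPath X) :
    raiseLinear k X (MonoidAlgebra.of k _ m) = MonoidAlgebra.of k _ m.raise := by
  simp [raiseLinear]

/-- The product of two arbitrary paths, valleys allowed, given by the same recursion as
`ValleyFreePath.diamond`. It takes values in the path algebra, where it can be combined with the
link product. -/
noncomputable def diamond (lam : k) (m m' : MotzkinPath X) : MonoidAlgebra k (MotzkinPath X) :=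
  open Classical in
  if h : m.EndsDown ∧ m'.StartsUp then
    let a := (m.exists_mul_raise h.1).choose
    let n := (m.exists_mul_raise h.1).choose_spec.choose
    let n' := (m'.exists_raise_mul h.2).choose
    let b := (m'.exists_raise_mul h.2).choose_spec.choose
    MonoidAlgebra.of k _ a *
      raiseLinear k X (diamond lam n n'.raise + diamond lam n.raise n' + lam • diamond lam n n') *
      MonoidAlgebra.of k _ b
  else MonoidAlgebra.of k _ (m * m')
termination_by m.steps.length + m'.steps.length
decreasing_by
  all_goals
    have e := congrArg (fun r => r.steps.length) (m.exists_mul_raise h.1).choose_spec.choose_spec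
    have e' := congrArg (fun r => r.steps.length) (m'.exists_raise_mul h.2).choose_spec.choose_spec
    simp at e e' ⊢
    omega

theorem diamond_of_not (lam : k) {m m' : MotzkinPath X} (h : ¬ (m.EndsDown ∧ m'.StartsUp)) :
    diamond lam m m' = MonoidAlgebra.of k _ (m * m') := by
  rw [diamond, dif_neg h]

theorem diamond_mul_raise_raise_mul (lam : k) (a n n' b : MotzkinPath X) :
    diamond lam (a * n.raise) (n'.raise * b) = MonoidAlgebra.of k _ a *
      raiseLinear k X (diamond lam n n'.raise + diamond lam n.raise n' + lam • diamond lam n n') *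
      MonoidAlgebra.of k _ b := by
  have h : (a * n.raise).EndsDown ∧ (n'.raise * b).StartsUp :=
    ⟨endsDown_mul_raise a n, startsUp_raise_mul n' b⟩
  rw [diamond, dif_pos h]
  obtain ⟨h1, h2⟩ := mul_raise_inj ((a * n.raise).exists_mul_raise h.1).choose_spec.choose_spec
  obtain ⟨h3, h4⟩ := raise_mul_inj ((n'.raise * b).exists_raise_mul h.2).choose_spec.choose_spec
  simp only [← h2, ← h4]
  simp only [← h1, ← h3]

theorem diamond_raise_raise (lam : k) (n n' : MotzkinPath X) :
    diamond lam n.raise n'.raise =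
      raiseLinear k X
        (diamond lam n n'.raise + diamond lam n.raise n' + lam • diamond lam n n') := by
  simpa only [one_mul, mul_one, map_one] using diamond_mul_raise_raise_mul lam 1 n n' 1

@[simp] theorem diamond_one_left (lam : k) (m : MotzkinPath X) :
    diamond lam 1 m = MonoidAlgebra.of k _ m := by
  rw [diamond_of_not lam fun h => not_endsDown_one h.1, one_mul]

@[simp] theorem diamond_one_right (lam : k) (m : MotzkinPath X) :
    diamond lam m 1 = MonoidAlgebra.of k _ m := by
  rw [diamond_of_not lam fun h => not_startsUp_one h.2, mul_one]

theorem diamond_mul_left (lam : k) (a m' : MotzkinPath X) {c : MotzkinPath X} (hc : c ≠ 1) :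
    diamond lam (a * c) m' = MonoidAlgebra.of k _ a * diamond lam c m' := by
  by_cases h : c.EndsDown ∧ m'.StartsUp
  · obtain ⟨c, n, rfl⟩ := c.exists_mul_raise h.1
    obtain ⟨n', b, rfl⟩ := m'.exists_raise_mul h.2
    rw [← mul_assoc a, diamond_mul_raise_raise_mul, diamond_mul_raise_raise_mul, map_mul]
    simp only [mul_assoc]
  · rw [diamond_of_not lam h, diamond_of_not lam (by rwa [endsDown_mul hc]), mul_assoc, map_mul]

theorem diamond_mul_right (lam : k) (m b : MotzkinPath X) {c : MotzkinPath X} (hc : c ≠ 1) :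
    diamond lam m (c * b) = diamond lam m c * MonoidAlgebra.of k _ b := by
  by_cases h : m.EndsDown ∧ c.StartsUp
  · obtain ⟨a, n, rfl⟩ := m.exists_mul_raise h.1
    obtain ⟨n', c, rfl⟩ := c.exists_raise_mul h.2
    rw [mul_assoc n'.raise, diamond_mul_raise_raise_mul, diamond_mul_raise_raise_mul, map_mul]
    simp only [mul_assoc]
  · rw [diamond_of_not lam h, diamond_of_not lam (by rwa [startsUp_mul hc]), ← mul_assoc, map_mul]

/-- The bilinear extension of the product of paths to the path algebra. -/
noncomputable def diamondLinear (lam : k) :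
    MonoidAlgebra k (MotzkinPath X) →ₗ[k] MonoidAlgebra k (MotzkinPath X) →ₗ[k]
      MonoidAlgebra k (MotzkinPath X) :=
  (MonoidAlgebra.basis (MotzkinPath X) k).constr k fun m =>
    (MonoidAlgebra.basis (MotzkinPath X) k).constr k fun m' => diamond lam m m'

@[simp] theorem diamondLinear_of_of (lam : k) (m m' : MotzkinPath X) :
    diamondLinear lam (MonoidAlgebra.of k _ m) (MonoidAlgebra.of k _ m') = diamond lam m m' := by
  have h : ∀ m : MotzkinPath X,
      MonoidAlgebra.of k _ m = MonoidAlgebra.basis (MotzkinPath X) k m := fun m => by simp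
  rw [h, h, diamondLinear, Module.Basis.constr_basis, Module.Basis.constr_basis]

variable (lam : k)

/-- A path that does not end in a down step acts from the left by the link product. -/
theorem diamondLinear_of_left {m : MotzkinPath X} (hm : ¬ m.EndsDown)
    (y : MonoidAlgebra k (MotzkinPath X)) :
    diamondLinear lam (MonoidAlgebra.of k _ m) y = MonoidAlgebra.of k _ m * y := by
  induction y using MonoidAlgebra.induction_on with
  | of m' => rw [diamondLinear_of_of, diamond_of_not lam fun h => hm h.1, map_mul]
  | add x y hx hy => rw [map_add, hx, hy, mul_add]
  | smul r x hx => rw [map_smul, hx, mul_smul_comm]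

/-- A path that does not start with an up step acts from the right by the link product. -/
theorem diamondLinear_of_right {m : MotzkinPath X} (hm : ¬ m.StartsUp)
    (y : MonoidAlgebra k (MotzkinPath X)) :
    diamondLinear lam y (MonoidAlgebra.of k _ m) = y * MonoidAlgebra.of k _ m := by
  induction y using MonoidAlgebra.induction_on with
  | of m' => rw [diamondLinear_of_of, diamond_of_not lam fun h => hm h.2, map_mul]
  | add x y hx hy => rw [map_add, LinearMap.add_apply, hx, hy, add_mul]
  | smul r x hx => rw [map_smul, LinearMap.smul_apply, hx, smul_mul_assoc]

theorem diamondLinear_mul_of (x y : MonoidAlgebra k (MotzkinPath X)) {c : MotzkinPath X}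
    (hc : c ≠ 1) :
    diamondLinear lam (x * MonoidAlgebra.of k _ c) y =
      x * diamondLinear lam (MonoidAlgebra.of k _ c) y := by
  induction x using MonoidAlgebra.induction_on with
  | of a =>
    induction y using MonoidAlgebra.induction_on with
    | of m => rw [← map_mul, diamondLinear_of_of, diamondLinear_of_of, diamond_mul_left lam a m hc]
    | add x y hx hy => rw [map_add, map_add, hx, hy, mul_add]
    | smul r x hx => rw [map_smul, map_smul, hx, mul_smul_comm]
  | add x y hx hy => rw [add_mul, map_add, LinearMap.add_apply, hx, hy, add_mul]
  | smul r x hx => rw [smul_mul_assoc, map_smul, LinearMap.smul_apply, hx, smul_mul_assoc]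

theorem diamondLinear_of_mul (x y : MonoidAlgebra k (MotzkinPath X)) {c : MotzkinPath X}
    (hc : c ≠ 1) :
    diamondLinear lam x (MonoidAlgebra.of k _ c * y) =
      diamondLinear lam x (MonoidAlgebra.of k _ c) * y := by
  induction y using MonoidAlgebra.induction_on with
  | of b =>
    induction x using MonoidAlgebra.induction_on with
    | of m => rw [← map_mul, diamondLinear_of_of, diamondLinear_of_of, diamond_mul_right lam m b hc]
    | add x y hx hy => simp only [map_add, LinearMap.add_apply, hx, hy, add_mul]
    | smul r x hx => simp only [map_smul, LinearMap.smul_apply, hx, smul_mul_assoc]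
  | add x y hx hy => rw [mul_add, map_add, hx, hy, mul_add]
  | smul r x hx => rw [mul_smul_comm, map_smul, hx, mul_smul_comm]

theorem diamondLinear_mul_raiseLinear (a x y : MonoidAlgebra k (MotzkinPath X)) :
    diamondLinear lam (a * raiseLinear k X x) y =
      a * diamondLinear lam (raiseLinear k X x) y := by
  induction x using MonoidAlgebra.induction_on with
  | of n => rw [raiseLinear_of, diamondLinear_mul_of lam _ _ (raise_ne_one n)]
  | add x y hx hy => simp only [map_add, mul_add, LinearMap.add_apply, hx, hy]
  | smul r x hx => simp only [map_smul, mul_smul_comm, LinearMap.smul_apply, hx]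

theorem diamondLinear_raiseLinear_mul (b x y : MonoidAlgebra k (MotzkinPath X)) :
    diamondLinear lam x (raiseLinear k X y * b) =
      diamondLinear lam x (raiseLinear k X y) * b := by
  induction y using MonoidAlgebra.induction_on with
  | of n => rw [raiseLinear_of, diamondLinear_of_mul lam _ _ (raise_ne_one n)]
  | add x y hx hy => simp only [map_add, add_mul, hx, hy]
  | smul r x hx => simp only [map_smul, smul_mul_assoc, hx]

/-- The Rota-Baxter identity for the raising operator on the path algebra. -/
theorem diamondLinear_raiseLinear_raiseLinear (x y : MonoidAlgebra k (MotzkinPath X)) :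
    diamondLinear lam (raiseLinear k X x) (raiseLinear k X y) =
      raiseLinear k X (diamondLinear lam x (raiseLinear k X y)) +
      raiseLinear k X (diamondLinear lam (raiseLinear k X x) y) +
      lam • raiseLinear k X (diamondLinear lam x y) := by
  induction x using MonoidAlgebra.induction_on with
  | of m =>
    induction y using MonoidAlgebra.induction_on with
    | of m' => simp [-MonoidAlgebra.of_apply, diamond_raise_raise]
    | add x y hx hy => simp only [map_add, hx, hy, smul_add]; abel
    | smul r x hx => simp only [map_smul, hx, smul_add, smul_comm r lam]
  | add x y hx hy => simp only [map_add, LinearMap.add_apply, hx, hy, smul_add]; abel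
  | smul r x hx => simp only [map_smul, LinearMap.smul_apply, hx, smul_add, smul_comm r lam]

/-- Associativity on three raised paths follows, by expanding both sides with the Rota-Baxter
identity, from associativity on the seven triples of fewer steps obtained by removing brackets. -/
theorem diamondLinear_assoc_raise {n n' n'' : MotzkinPath X}
    (h : ∀ m m' m'' : MotzkinPath X,
      m.steps.length + m'.steps.length + m''.steps.length <
        n.raise.steps.length + n'.raise.steps.length + n''.raise.steps.length →
      diamondLinear lam (diamond lam m m') (MonoidAlgebra.of k _ m'') =
        diamondLinear lam (MonoidAlgebra.of k _ m) (diamond lam m' m'')) :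
    diamondLinear lam (diamond lam n.raise n'.raise) (MonoidAlgebra.of k _ n''.raise) =
      diamondLinear lam (MonoidAlgebra.of k _ n.raise) (diamond lam n'.raise n''.raise) := by
  have h1 := h n n' n'' (by simp; omega)
  have h2 := h n.raise n' n'' (by simp; omega)
  have h3 := h n n'.raise n'' (by simp; omega)
  have h4 := h n n' n''.raise (by simp; omega)
  have h5 := h n.raise n'.raise n'' (by simp)
  have h6 := h n.raise n' n''.raise (by simp)
  have h7 := h n n'.raise n''.raise (by simp)
  simp only [← diamondLinear_of_of, ← raiseLinear_of] at h1 h2 h3 h4 h5 h6 h7 ⊢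
  set P := raiseLinear k X
  set D := diamondLinear (X := X) lam
  set x := MonoidAlgebra.of k _ n
  set y := MonoidAlgebra.of k _ n'
  set z := MonoidAlgebra.of k _ n''
  have rb : ∀ x y, D (P x) (P y) = P (D x (P y)) + P (D (P x) y) + lam • P (D x y) :=
    diamondLinear_raiseLinear_raiseLinear lam
  have hl : D (D (P x) (P y)) (P z) =
      P (D (D x (P y)) (P z) + D (D (P x) (P y)) z + lam • D (D x (P y)) z +
        D (D (P x) y) (P z) + lam • D (D (P x) y) z + lam • D (D x y) (P z) +
        lam • lam • D (D x y) z) := by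
    conv_lhs => rw [rb x y]
    simp only [map_add, map_smul, LinearMap.add_apply, LinearMap.smul_apply, rb (D _ _) z]
    simp only [rb x y, map_add, map_smul, LinearMap.add_apply, LinearMap.smul_apply, smul_add]
    abel
  have hr : D (P x) (D (P y) (P z)) =
      P (D x (D (P y) (P z)) + D (P x) (D (P y) z) + lam • D x (D (P y) z) +
        D (P x) (D y (P z)) + lam • D (P x) (D y z) + lam • D x (D y (P z)) +
        lam • lam • D x (D y z)) := by
    conv_lhs => rw [rb y z]
    simp only [map_add, map_smul, rb x (D _ _)]
    simp only [rb y z, map_add, map_smul, smul_add]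
    abel
  rw [hl, hr, h1, h2, h3, h4, h5, h6, h7]

theorem diamondLinear_assoc_of (m m' m'' : MotzkinPath X) :
    diamondLinear lam (diamond lam m m') (MonoidAlgebra.of k _ m'') =
      diamondLinear lam (MonoidAlgebra.of k _ m) (diamond lam m' m'') := by
  induction hN : m.steps.length + m'.steps.length + m''.steps.length
    using Nat.strong_induction_on generalizing m m' m'' with
  | _ N ih =>
    subst hN
    -- If the middle factor splits, the two products do not interact.
    have split : ∀ b c : MotzkinPath X, b ≠ 1 → c ≠ 1 → m' = b * c →
        diamondLinear lam (diamond lam m m') (MonoidAlgebra.of k _ m'') =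
          diamondLinear lam (MonoidAlgebra.of k _ m) (diamond lam m' m'') := by
      rintro b c hb hc rfl
      rw [diamond_mul_right lam m c hb, diamondLinear_mul_of lam _ _ hc,
        diamond_mul_left lam b m'' hc, diamondLinear_of_mul lam _ _ hb, diamondLinear_of_of,
        diamondLinear_of_of]
    -- If `m` or `m''` does not meet `m'` in a valley, all its products are link products.
    have left : m' ≠ 1 → ¬ m.EndsDown →
        diamondLinear lam (diamond lam m m') (MonoidAlgebra.of k _ m'') =
          diamondLinear lam (MonoidAlgebra.of k _ m) (diamond lam m' m'') := by
      intro h' hm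
      rw [diamondLinear_of_left lam hm, diamond_of_not lam (m := m) fun h => hm h.1,
        map_mul (MonoidAlgebra.of _ _), diamondLinear_mul_of lam _ _ h', diamondLinear_of_of]
    have right : m' ≠ 1 → ¬ m''.StartsUp →
        diamondLinear lam (diamond lam m m') (MonoidAlgebra.of k _ m'') =
          diamondLinear lam (MonoidAlgebra.of k _ m) (diamond lam m' m'') := by
      intro h' hm
      rw [diamondLinear_of_right lam hm, diamond_of_not lam (m' := m'') fun h => hm h.2,
        map_mul (MonoidAlgebra.of _ _), diamondLinear_of_mul lam _ _ h', diamondLinear_of_of]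
    rcases m'.eq_one_or_level_mul_or_startsUp with rfl | ⟨x, r, rfl⟩ | h'
    · simp only [diamond_one_left, diamond_one_right]
    · by_cases hr : r = 1
      · subst hr
        rw [mul_one, diamond_of_not lam (m := m) fun h => not_startsUp_level x h.2,
          diamond_of_not lam (m' := m'') fun h => not_endsDown_level x h.1,
          map_mul (MonoidAlgebra.of _ _), map_mul (MonoidAlgebra.of _ _),
          diamondLinear_mul_of lam _ _ (level_ne_one x),
          diamondLinear_of_mul lam _ _ (level_ne_one x),
          diamondLinear_of_left lam (not_endsDown_level x),
          diamondLinear_of_right lam (not_startsUp_level x), mul_assoc]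
      · exact split _ _ (level_ne_one x) hr rfl
    · obtain ⟨n', r, rfl⟩ := m'.exists_raise_mul h'
      by_cases hr : r = 1
      swap
      · exact split _ _ (raise_ne_one n') hr rfl
      subst hr
      by_cases hm : m.EndsDown
      swap
      · exact left (raise_mul_ne_one n' 1) hm
      by_cases hm'' : m''.StartsUp
      swap
      · exact right (raise_mul_ne_one n' 1) hm''
      obtain ⟨a, n, rfl⟩ := m.exists_mul_raise hm
      obtain ⟨n'', b, rfl⟩ := m''.exists_raise_mul hm''
      have key := diamondLinear_assoc_raise lam (n := n) (n' := n') (n'' := n'')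
        fun p p' p'' hp => ih _ (hp.trans_le (by simp; omega)) p p' p'' rfl
      rw [mul_one, diamond_mul_left lam a _ (raise_ne_one n),
        diamond_mul_right lam _ b (raise_ne_one n''), map_mul (MonoidAlgebra.of _ _) n''.raise,
        map_mul (MonoidAlgebra.of _ _) a, diamondLinear_of_mul lam _ _ (raise_ne_one n''),
        diamondLinear_mul_of lam _ _ (raise_ne_one n), diamond_raise_raise lam n n',
        diamond_raise_raise lam n' n'', diamondLinear_mul_raiseLinear,
        diamondLinear_raiseLinear_mul, ← diamond_raise_raise, ← diamond_raise_raise, key, mul_assoc]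

theorem diamondLinear_assoc (x y z : MonoidAlgebra k (MotzkinPath X)) :
    diamondLinear lam (diamondLinear lam x y) z = diamondLinear lam x (diamondLinear lam y z) := by
  induction x using MonoidAlgebra.induction_on with
  | of m =>
    induction y using MonoidAlgebra.induction_on with
    | of m' =>
      induction z using MonoidAlgebra.induction_on with
      | of m'' => rw [diamondLinear_of_of, diamondLinear_of_of, diamondLinear_assoc_of]
      | add x y hx hy => simp only [map_add, hx, hy]
      | smul r x hx => simp only [map_smul, hx]
    | add x y hx hy => simp only [map_add, LinearMap.add_apply, hx, hy]
    | smul r x hx => simp only [map_smul, LinearMap.smul_apply, hx]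
  | add x y hx hy => simp only [map_add, LinearMap.add_apply, hx, hy]
  | smul r x hx => simp only [map_smul, LinearMap.smul_apply, hx]

end MotzkinPath

/-! ### Evaluating paths in an algebra with an operator -/

namespace MotzkinPath

variable {k : Type u} [CommRing k] {X : Type v} {R : Type w} [Ring R]

/-- Evaluation of a sequence of steps with a stack: `c` is the value of the part of the path since
the last unmatched up step, and `s` lists the values of the parts between the earlier unmatched up
steps. The value for an unmatched down step is arbitrary, as no path has one. -/
def evalSteps (Q : R → R) (f : X → R) : List (MotzkinStep X) → R → List R → R
  | [], c, _ => c
  | .level x :: l, c, s => evalSteps Q f l (c * f x) s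
  | .up :: l, c, s => evalSteps Q f l 1 (c :: s)
  | .down :: l, c, d :: s => evalSteps Q f l (d * Q c) s
  | .down :: _, c, [] => c

/-- The value of a path in `R`: a level step decorated by `x` has the value `f x`, the raising
operator is interpreted as `Q`, and the link product as the product of `R`. -/
def eval (Q : R → R) (f : X → R) (m : MotzkinPath X) : R := evalSteps Q f m.steps 1 []

theorem evalSteps_append (Q : R → R) (f : X → R) (m : MotzkinPath X) :
    ∀ (c : R) (l : List (MotzkinStep X)) (s : List R),
      evalSteps Q f (m.steps ++ l) c s = evalSteps Q f l (c * eval Q f m) s := by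
  suffices h : ∃ e : R, ∀ (c : R) (l : List (MotzkinStep X)) (s : List R),
      evalSteps Q f (m.steps ++ l) c s = evalSteps Q f l (c * e) s by
    obtain ⟨e, he⟩ := h
    have : eval Q f m = e := by simpa [eval, evalSteps] using he 1 [] []
    rwa [this]
  induction m using factor_induction with
  | one => exact ⟨1, by simp⟩
  | level_mul x r h =>
    obtain ⟨e, he⟩ := h
    exact ⟨f x * e, fun c l s => by simp [evalSteps, he, mul_assoc]⟩
  | raise_mul n r hn hr =>
    obtain ⟨d, hd⟩ := hn
    obtain ⟨e, he⟩ := hr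
    exact ⟨Q d * e, fun c l s => by simp [evalSteps, hd, he, mul_assoc]⟩

/-- Evaluation of paths is multiplicative for the link product. -/
def evalHom (Q : R → R) (f : X → R) : MotzkinPath X →* R where
  toFun := eval Q f
  map_one' := rfl
  map_mul' m m' := by
    have := evalSteps_append Q f m' (1 * eval Q f m) [] []
    rw [← evalSteps_append, List.append_nil] at this
    simpa [eval, evalSteps] using this

theorem evalHom_apply (Q : R → R) (f : X → R) (m : MotzkinPath X) :
    evalHom Q f m = evalSteps Q f m.steps 1 [] := rfl

@[simp] theorem evalHom_level (Q : R → R) (f : X → R) (x : X) :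
    evalHom Q f (level x) = f x := by
  simp [evalHom_apply, evalSteps]

@[simp] theorem evalHom_raise (Q : R → R) (f : X → R) (m : MotzkinPath X) :
    evalHom Q f m.raise = Q (evalHom Q f m) := by
  simp [evalHom_apply, evalSteps, evalSteps_append, eval]

variable [Algebra k R] (Q : R →ₗ[k] R) (f : X → R)

/-- The linear extension of the evaluation of paths. -/
noncomputable def evalAlgHom : MonoidAlgebra k (MotzkinPath X) →ₐ[k] R :=
  MonoidAlgebra.lift k R (MotzkinPath X) (evalHom Q f)

@[simp] theorem evalAlgHom_of (m : MotzkinPath X) :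
    evalAlgHom Q f (MonoidAlgebra.of k _ m) = evalHom Q f m := by
  simp only [evalAlgHom, MonoidAlgebra.lift_of]

theorem evalAlgHom_raiseLinear (x : MonoidAlgebra k (MotzkinPath X)) :
    evalAlgHom Q f (raiseLinear k X x) = Q (evalAlgHom Q f x) := by
  induction x using MonoidAlgebra.induction_on with
  | of m => rw [raiseLinear_of, evalAlgHom_of, evalAlgHom_of, evalHom_raise]
  | add x y hx hy => simp only [map_add, hx, hy]
  | smul r x hx => simp only [map_smul, hx]

/-- Evaluation turns the Rota-Baxter product of paths into the product of `R`. The Rota-Baxter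
identity is needed only on the values of those paths that occur inside raised factors; for peak-free
paths these are nontrivial, which matters when `R` is the unitization of a nonunitary algebra. -/
theorem evalAlgHom_diamond (lam : k) (C : MotzkinPath X → Prop)
    (mul_left : ∀ a b, C (a * b) → C a) (mul_right : ∀ a b, C (a * b) → C b)
    (of_raise : ∀ n : MotzkinPath X, C n.raise → C n)
    (hQ : ∀ n n' : MotzkinPath X, C n.raise → C n'.raise →
      Q (evalHom Q f n) * Q (evalHom Q f n') = Q (evalHom Q f n * Q (evalHom Q f n')) +
        Q (Q (evalHom Q f n) * evalHom Q f n') + lam • Q (evalHom Q f n * evalHom Q f n'))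
    (m m' : MotzkinPath X) (hm : C m) (hm' : C m') :
    evalAlgHom Q f (diamond lam m m') = evalHom Q f m * evalHom Q f m' := by
  induction hN : m.steps.length + m'.steps.length using Nat.strong_induction_on
    generalizing m m' with
  | _ N ih =>
    subst hN
    by_cases h : m.EndsDown ∧ m'.StartsUp
    · obtain ⟨a, n, rfl⟩ := m.exists_mul_raise h.1
      obtain ⟨n', b, rfl⟩ := m'.exists_raise_mul h.2
      have hn := mul_right _ _ hm
      have hn' := mul_left _ _ hm'
      have e1 := ih _ (by simp; omega) n n'.raise (of_raise n hn) hn' rfl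
      have e2 := ih _ (by simp; omega) n.raise n' hn (of_raise n' hn') rfl
      have e3 := ih _ (by simp; omega) n n' (of_raise n hn) (of_raise n' hn') rfl
      simp only [diamond_mul_raise_raise_mul, map_mul, evalAlgHom_raiseLinear, map_add, map_smul,
        e1, e2, e3, evalAlgHom_of, evalHom_raise]
      rw [← hQ n n' hn hn']
      simp only [mul_assoc]
    · rw [diamond_of_not lam h, evalAlgHom_of, map_mul]

theorem evalAlgHom_diamondLinear {lam : k} (hQ : IsRotaBaxterOperator lam Q)
    (x y : MonoidAlgebra k (MotzkinPath X)) :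
    evalAlgHom Q f (diamondLinear lam x y) = evalAlgHom Q f x * evalAlgHom Q f y := by
  induction x using MonoidAlgebra.induction_on with
  | of m =>
    induction y using MonoidAlgebra.induction_on with
    | of m' =>
      rw [diamondLinear_of_of, evalAlgHom_of, evalAlgHom_of]
      exact evalAlgHom_diamond Q f lam (fun _ => True) (fun _ _ _ => trivial)
        (fun _ _ _ => trivial) (fun _ _ => trivial) (fun _ _ _ _ => hQ _ _) m m' trivial trivial
    | add x y hx hy => simp only [map_add, hx, hy, mul_add]
    | smul r x hx => simp only [map_smul, hx, mul_smul_comm]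
  | add x y hx hy => simp only [map_add, LinearMap.add_apply, hx, hy, add_mul]
  | smul r x hx => simp only [map_smul, LinearMap.smul_apply, hx, smul_mul_assoc]

end MotzkinPath

/-! ### The product on valley-free paths -/

section Transfer

open MotzkinPath

variable {k : Type u} [CommRing k] {X : Type v}

@[simp] theorem toPathAlgebra_single (m : ValleyFreePath X) :
    toPathAlgebra k X (Finsupp.single m 1) = MonoidAlgebra.of k _ m.1 := by
  simp [toPathAlgebra]

theorem toPathAlgebra_injective : Function.Injective (toPathAlgebra k X) := by
  have h : toPathAlgebra k X = (MonoidAlgebra.coeffLinearEquiv k).symm.toLinearMap ∘ₗ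
      Finsupp.lmapDomain k k Subtype.val := by
    ext m : 2
    simp [toPathAlgebra, MonoidAlgebra.coeffLinearEquiv]
  rw [h, LinearMap.coe_comp]
  exact (LinearEquiv.injective _).comp (Finsupp.mapDomain_injective Subtype.val_injective)

theorem toPathAlgebra_raiseOp (x : ValleyFreePath X →₀ k) :
    toPathAlgebra k X (raiseOp k X x) = raiseLinear k X (toPathAlgebra k X x) := by
  refine LinearMap.congr_fun (f := toPathAlgebra k X ∘ₗ raiseOp k X)
    (g := raiseLinear k X ∘ₗ toPathAlgebra k X) ?_ x
  ext m : 2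
  simp only [LinearMap.comp_apply, Finsupp.lsingle_apply, raiseOp, Finsupp.lmapDomain_apply,
    Finsupp.mapDomain_single, toPathAlgebra_single, raiseLinear_of]
  rfl

theorem toPathAlgebra_mapDomain_sandwich (a b : ValleyFreePath X) (ha : ¬ a.1.EndsDown)
    (hb : ¬ b.1.StartsUp) (x : ValleyFreePath X →₀ k) :
    toPathAlgebra k X (Finsupp.mapDomain (ValleyFreePath.sandwich a b ha hb) x) =
      MonoidAlgebra.of k _ a.1 * raiseLinear k X (toPathAlgebra k X x) *
        MonoidAlgebra.of k _ b.1 := by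
  induction x using Finsupp.induction_linear with
  | zero => simp
  | add x y hx hy => simp only [Finsupp.mapDomain_add, map_add, hx, hy, mul_add, add_mul]
  | single m r =>
    rw [← mul_one r, ← smul_eq_mul, ← Finsupp.smul_single, Finsupp.mapDomain_smul, map_smul,
      map_smul, map_smul, Finsupp.mapDomain_single, toPathAlgebra_single, toPathAlgebra_single,
      raiseLinear_of, mul_smul_comm, smul_mul_assoc, ← map_mul, ← map_mul]
    rfl

theorem toPathAlgebra_diamond (lam : k) (m m' : ValleyFreePath X) :
    toPathAlgebra k X (ValleyFreePath.diamond lam m m') = MotzkinPath.diamond lam m.1 m'.1 := by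
  induction hN : m.1.steps.length + m'.1.steps.length using Nat.strong_induction_on
    generalizing m m' with
  | _ N ih =>
    subst hN
    rw [ValleyFreePath.diamond]
    by_cases h : m.1.EndsDown ∧ m'.1.StartsUp
    · rw [dif_pos h]
      have e := ValleyFreePath.eq_beforeLast_mul m h.1
      have e' := ValleyFreePath.eq_mul_afterFirst m' h.2
      have l := congrArg (fun r => r.steps.length) e
      have l' := congrArg (fun r => r.steps.length) e'
      simp only [steps_mul, steps_raise, List.length_append, List.length_cons,
        List.length_nil] at l l'
      rw [toPathAlgebra_mapDomain_sandwich]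
      rw [(congrArg₂ (MotzkinPath.diamond lam) e e').trans
        (diamond_mul_raise_raise_mul lam _ _ _ _), map_add (toPathAlgebra k X),
        map_add (toPathAlgebra k X), map_smul (toPathAlgebra k X), ih _ _ _ _ rfl,
        ih _ _ _ _ rfl, ih _ _ _ _ rfl]
      · rfl
      all_goals
        try simp only [ValleyFreePath.raise, steps_raise, List.length_append, List.length_cons,
          List.length_nil]
        omega
    · rw [dif_neg h, toPathAlgebra_single, diamond_of_not lam h]

@[simp] theorem diamondMul_single_single (lam : k) (m m' : ValleyFreePath X) :
    diamondMul lam (Finsupp.single m 1) (Finsupp.single m' 1) =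
      ValleyFreePath.diamond lam m m' := by
  simp [diamondMul]

theorem toPathAlgebra_diamondMul (lam : k) (x y : ValleyFreePath X →₀ k) :
    toPathAlgebra k X (diamondMul lam x y) =
      diamondLinear lam (toPathAlgebra k X x) (toPathAlgebra k X y) := by
  have h : (diamondMul lam).compr₂ (toPathAlgebra k X) =
      (diamondLinear lam).compl₁₂ (toPathAlgebra k X) (toPathAlgebra k X) := by
    ext m m' : 4
    simp only [LinearMap.comp_apply, Finsupp.lsingle_apply, LinearMap.compr₂_apply,
      LinearMap.compl₁₂_apply, diamondMul_single_single, toPathAlgebra_diamond,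
      toPathAlgebra_single, diamondLinear_of_of]
  exact LinearMap.congr_fun₂ h x y

end Transfer

/-! ### The characterization of the product, and the free unitary algebra -/

section FreeUnitary

open MotzkinPath

variable {k : Type u} [CommRing k] {X : Type v} (lam : k)

theorem raiseOp_single (n : ValleyFreePath X) :
    raiseOp k X (Finsupp.single n 1) = Finsupp.single n.raise 1 := by
  simp [raiseOp]

theorem diamondMul_raiseOp_raiseOp (x y : ValleyFreePath X →₀ k) :
    diamondMul lam (raiseOp k X x) (raiseOp k X y) =
      raiseOp k X (diamondMul lam x (raiseOp k X y)) +
      raiseOp k X (diamondMul lam (raiseOp k X x) y) +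
      lam • raiseOp k X (diamondMul lam x y) := by
  apply toPathAlgebra_injective
  simp only [map_add, map_smul, toPathAlgebra_diamondMul, toPathAlgebra_raiseOp]
  exact diamondLinear_raiseLinear_raiseLinear lam _ _

theorem diamondMul_assoc (x y z : ValleyFreePath X →₀ k) :
    diamondMul lam (diamondMul lam x y) z = diamondMul lam x (diamondMul lam y z) := by
  apply toPathAlgebra_injective
  simp only [toPathAlgebra_diamondMul, diamondLinear_assoc]

theorem toPathAlgebra_trivialPath :
    toPathAlgebra k X (Finsupp.single ValleyFreePath.trivialPath 1) = MonoidAlgebra.of k _ 1 :=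
  toPathAlgebra_single _

theorem trivialPath_diamondMul (x : ValleyFreePath X →₀ k) :
    diamondMul lam (Finsupp.single ValleyFreePath.trivialPath 1) x = x := by
  apply toPathAlgebra_injective
  rw [toPathAlgebra_diamondMul, toPathAlgebra_trivialPath,
    diamondLinear_of_left lam not_endsDown_one, map_one, one_mul]

theorem diamondMul_trivialPath (x : ValleyFreePath X →₀ k) :
    diamondMul lam x (Finsupp.single ValleyFreePath.trivialPath 1) = x := by
  apply toPathAlgebra_injective
  rw [toPathAlgebra_diamondMul, toPathAlgebra_trivialPath,
    diamondLinear_of_right lam not_startsUp_one, map_one, mul_one]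

theorem isRotaBaxterAlgebra_diamondMul :
    IsRotaBaxterAlgebra lam (diamondMul lam) (Finsupp.single ValleyFreePath.trivialPath 1)
      (raiseOp k X) where
  assoc := diamondMul_assoc lam
  rotaBaxter := diamondMul_raiseOp_raiseOp lam
  one_mul := trivialPath_diamondMul lam
  mul_one := diamondMul_trivialPath lam

theorem diamondMul_single_of_not {m m' : ValleyFreePath X}
    (h : ¬ (m.1.EndsDown ∧ m'.1.StartsUp)) :
    diamondMul lam (Finsupp.single m 1) (Finsupp.single m' 1) =
      Finsupp.single ⟨m.1 * m'.1, m.2.mul m'.2 h⟩ 1 := by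
  rw [diamondMul_single_single, ValleyFreePath.diamond, dif_neg h]

theorem isDiamondProduct_diamondMul : IsDiamondProduct (X := X) lam (diamondMul lam) where
  one_mul := trivialPath_diamondMul lam
  mul_one := diamondMul_trivialPath lam
  level m m' _ _ _ _ h := by
    rw [diamondMul_single_of_not, toPathAlgebra_single]
    rintro ⟨h1, h2⟩
    rcases h with ⟨x, rfl⟩ | ⟨x, rfl⟩
    · exact not_endsDown_level x h1
    · exact not_startsUp_level x h2
  raise_raise n n' := by
    simpa only [raiseOp_single] using
      diamondMul_raiseOp_raiseOp lam (Finsupp.single n (1 : k)) (Finsupp.single n' 1)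
  link m m' n n' l l' _ _ hn _ hn' _ hm hm' := by
    rw [diamondMul_single_single, diamondMul_single_single, toPathAlgebra_diamond,
      toPathAlgebra_diamond, hm, hm', diamond_mul_left lam _ _ hn, diamond_mul_right lam _ _ hn',
      mul_assoc]

/-- The defining properties determine the product: linking reduces it to two indecomposable paths,
where it is either a link product or given by the recursion. -/
theorem IsDiamondProduct.eq_diamondMul
    {mul : (ValleyFreePath X →₀ k) →ₗ[k] (ValleyFreePath X →₀ k) →ₗ[k] (ValleyFreePath X →₀ k)}
    (h : IsDiamondProduct lam mul) : mul = diamondMul lam := by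
  have h' := isDiamondProduct_diamondMul (X := X) lam
  suffices key : ∀ m m' : ValleyFreePath X, mul (Finsupp.single m 1) (Finsupp.single m' 1) =
      diamondMul lam (Finsupp.single m 1) (Finsupp.single m' 1) by
    ext m m' : 4
    exact key m m'
  intro m m'
  induction hN : m.1.steps.length + m'.1.steps.length using Nat.strong_induction_on
    generalizing m m' with
  | _ N ih =>
    subst hN
    obtain ⟨l, hl, hfac⟩ := m.1.exists_list_prod
    obtain ⟨l', hl', hfac'⟩ := m'.1.exists_list_prod
    rcases List.eq_nil_or_concat l with rfl | ⟨l, p, rfl⟩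
    · obtain rfl : m = ValleyFreePath.trivialPath := Subtype.ext hl
      rw [h.one_mul, h'.one_mul]
    rcases l' with _ | ⟨p', l'⟩
    · obtain rfl : m' = ValleyFreePath.trivialPath := Subtype.ext hl'
      rw [h.mul_one, h'.mul_one]
    rw [List.concat_eq_append] at hl hfac
    rw [List.prod_append, List.prod_singleton] at hl
    rw [List.prod_cons] at hl'
    have hp := hfac p (by simp)
    have hp' := hfac' p' (by simp)
    let n : ValleyFreePath X := ⟨p, (hl ▸ m.2).of_mul_right⟩
    let n' : ValleyFreePath X := ⟨p', (hl' ▸ m'.2).of_mul_left⟩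
    have hi : ∀ q ∈ l, q.Indecomposable ∧ q ≠ 1 := fun q hq =>
      indecomposable_and_ne_one (hfac q (by simp [hq]))
    have hi' : ∀ q ∈ l', q.Indecomposable ∧ q ≠ 1 := fun q hq =>
      indecomposable_and_ne_one (hfac' q (by simp [hq]))
    obtain ⟨hn, hn1⟩ := indecomposable_and_ne_one hp
    obtain ⟨hn', hn1'⟩ := indecomposable_and_ne_one hp'
    have hlen : n.1.steps.length + n'.1.steps.length ≤
        m.1.steps.length + m'.1.steps.length := by
      rw [hl, hl']
      simp only [steps_mul, List.length_append, n, n']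
      omega
    apply toPathAlgebra_injective
    rw [h.link m m' n n' l l' hi hn hn1 hn' hn1' hi' hl hl',
      h'.link m m' n n' l l' hi hn hn1 hn' hn1' hi' hl hl']
    congr 2
    by_cases hx : (∃ x, n = ValleyFreePath.level x) ∨ ∃ x, n' = ValleyFreePath.level x
    · rw [h.level n n' hn hn1 hn' hn1' hx, h'.level n n' hn hn1 hn' hn1' hx]
    obtain ⟨q, hq⟩ : ∃ q : ValleyFreePath X, n = q.raise := by
      rcases hp with ⟨x, hx'⟩ | ⟨q, hq⟩
      · exact absurd (Or.inl ⟨x, Subtype.ext hx'⟩) hx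
      · exact ⟨⟨q, (hq ▸ n.2 : q.raise.ValleyFree).of_raise⟩, Subtype.ext hq⟩
    obtain ⟨q', hq'⟩ : ∃ q : ValleyFreePath X, n' = q.raise := by
      rcases hp' with ⟨x, hx'⟩ | ⟨q, hq⟩
      · exact absurd (Or.inr ⟨x, Subtype.ext hx'⟩) hx
      · exact ⟨⟨q, (hq ▸ n'.2 : q.raise.ValleyFree).of_raise⟩, Subtype.ext hq⟩
    rw [hq, hq'] at hlen ⊢
    simp only [ValleyFreePath.raise, steps_raise, List.length_append, List.length_cons,
      List.length_nil] at hlen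
    rw [h.raise_raise, h'.raise_raise, ih _ ?_ q q'.raise rfl, ih _ ?_ q.raise q' rfl,
      ih _ ?_ q q' rfl]
    all_goals
      try simp only [ValleyFreePath.raise, steps_raise, List.length_append, List.length_cons,
        List.length_nil]
      omega

theorem isFreeRotaBaxterAlgebra_diamondMul :
    IsFreeRotaBaxterAlgebra.{u, v, w, max u v} lam (diamondMul lam)
      (Finsupp.single ValleyFreePath.trivialPath 1) (raiseOp k X) (levelMap k) where
  isRotaBaxterAlgebra := isRotaBaxterAlgebra_diamondMul lam
  existsUnique_lift R _ _ Q hQ f := by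
    refine ⟨(evalAlgHom Q f).toLinearMap ∘ₗ toPathAlgebra k X, ⟨?_, ?_, ?_, ?_⟩, ?_⟩
    · simp only [LinearMap.comp_apply, AlgHom.toLinearMap_apply, toPathAlgebra_trivialPath,
        map_one]
    · intro a b
      simp only [LinearMap.comp_apply, AlgHom.toLinearMap_apply, toPathAlgebra_diamondMul,
        evalAlgHom_diamondLinear Q f hQ]
    · intro a
      simp only [LinearMap.comp_apply, AlgHom.toLinearMap_apply, toPathAlgebra_raiseOp,
        evalAlgHom_raiseLinear]
    · intro x
      simp only [LinearMap.comp_apply, AlgHom.toLinearMap_apply, levelMap, toPathAlgebra_single,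
        evalAlgHom_of]
      exact evalHom_level _ f x
    · rintro ψ ⟨h_one, h_mul, h_raise, h_level⟩
      ext m : 2
      obtain ⟨m, hm⟩ := m
      simp only [LinearMap.comp_apply, AlgHom.toLinearMap_apply, Finsupp.lsingle_apply,
        toPathAlgebra_single, evalAlgHom_of]
      induction m using factor_induction with
      | one => rw [map_one]; exact h_one
      | level_mul x r ih =>
        have hr := hm.of_mul_right
        have e := diamondMul_single_of_not lam (m := ValleyFreePath.level x) (m' := ⟨r, hr⟩)
          fun h => not_endsDown_level x h.1
        rw [map_mul, evalHom_level, ← ih hr, ← h_level, levelMap, ← h_mul, e]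
        rfl
      | raise_mul n r ihn ihr =>
        have hn := hm.of_mul_left.of_raise
        have hr := hm.of_mul_right
        have e := diamondMul_single_of_not lam (m := ValleyFreePath.raise ⟨n, hn⟩) (m' := ⟨r, hr⟩)
          hm.not_endsDown_and_startsUp
        rw [map_mul, evalHom_raise, ← ihn hn, ← ihr hr, ← h_raise, raiseOp_single, ← h_mul, e]
        rfl

end FreeUnitary

/-! ### The free nonunitary algebra on paths without valleys and peaks -/

section FreeNonunitary

open MotzkinPath

variable {k : Type u} [CommRing k] {X : Type v} (lam : k)

theorem peakFreeInclusion_injective : Function.Injective (peakFreeInclusion k X) :=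
  Finsupp.mapDomain_injective fun _ _ h => Subtype.ext (congrArg (fun p => p.1) h)

@[simp] theorem peakFreeInclusion_single (m : ValleyPeakFreePath X) :
    peakFreeInclusion k X (Finsupp.single m 1) = Finsupp.single ⟨m.1, m.2.1⟩ 1 := by
  simp [peakFreeInclusion]

theorem mapDomain_sandwich_mem_range (a b : ValleyFreePath X) (ha : ¬ a.1.EndsDown)
    (hb : ¬ b.1.StartsUp) (ha' : a.1.NoPeak) (hb' : b.1.NoPeak) {x : ValleyFreePath X →₀ k}
    (hx : x ∈ LinearMap.range (peakFreeInclusion k X)) :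
    Finsupp.mapDomain (ValleyFreePath.sandwich a b ha hb) x ∈
      LinearMap.range (peakFreeInclusion k X) := by
  obtain ⟨y, rfl⟩ := hx
  let g : ValleyPeakFreePath X → ValleyPeakFreePath X := fun v =>
    ⟨a.1 * v.1.raise * b.1, (ValleyFreePath.sandwich a b ha hb ⟨v.1, v.2.1⟩).2,
      fun h => raise_ne_one v.1 (mul_eq_one.1 (mul_eq_one.1 h).1).2,
      (ha'.mul v.2.2.raise.noPeak).mul hb'⟩
  refine ⟨Finsupp.mapDomain g y, ?_⟩
  simp only [peakFreeInclusion, Finsupp.lmapDomain_apply, ← Finsupp.mapDomain_comp]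
  rfl

theorem diamond_mem_range (m m' : ValleyFreePath X) (hm : m.1.PeakFree) (hm' : m'.1.PeakFree) :
    ValleyFreePath.diamond lam m m' ∈ LinearMap.range (peakFreeInclusion k X) := by
  induction hN : m.1.steps.length + m'.1.steps.length using Nat.strong_induction_on
    generalizing m m' with
  | _ N ih =>
    subst hN
    rw [ValleyFreePath.diamond]
    by_cases h : m.1.EndsDown ∧ m'.1.StartsUp
    · rw [dif_pos h]
      have e := ValleyFreePath.eq_beforeLast_mul m h.1
      have e' := ValleyFreePath.eq_mul_afterFirst m' h.2
      have l := congrArg (fun r => r.steps.length) e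
      have l' := congrArg (fun r => r.steps.length) e'
      have p := hm.noPeak
      have p' := hm'.noPeak
      rw [e] at p
      rw [e'] at p'
      have hn := p.of_mul_right.peakFree_of_raise
      have hn' := p'.of_mul_left.peakFree_of_raise
      simp only [steps_mul, steps_raise, List.length_append, List.length_cons,
        List.length_nil] at l l'
      refine mapDomain_sandwich_mem_range _ _ _ _ p.of_mul_left p'.of_mul_right
        (Submodule.add_mem _ (Submodule.add_mem _ (ih _ ?_ _ _ hn hn'.raise rfl)
          (ih _ ?_ _ _ hn.raise hn' rfl)) (Submodule.smul_mem _ _ (ih _ ?_ _ _ hn hn' rfl)))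
      all_goals
        try simp only [ValleyFreePath.raise, steps_raise, List.length_append, List.length_cons,
          List.length_nil]
        omega
    · rw [dif_neg h]
      exact ⟨Finsupp.single ⟨m.1 * m'.1, m.2.mul m'.2 h, hm.mul hm'⟩ 1,
        peakFreeInclusion_single _⟩

/-- The product on the free module on valley-free peak-free paths, for which the inclusion into the
module on all valley-free paths is multiplicative. -/
theorem exists_peakFree_mul :
    ∃ mul : (ValleyPeakFreePath X →₀ k) →ₗ[k] (ValleyPeakFreePath X →₀ k) →ₗ[k]
        (ValleyPeakFreePath X →₀ k),
      ∀ a b, peakFreeInclusion k X (mul a b) =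
        diamondMul lam (peakFreeInclusion k X a) (peakFreeInclusion k X b) := by
  choose g hg using fun m m' : ValleyPeakFreePath X =>
    diamond_mem_range lam ⟨m.1, m.2.1⟩ ⟨m'.1, m'.2.1⟩ m.2.2 m'.2.2
  let mul : (ValleyPeakFreePath X →₀ k) →ₗ[k] (ValleyPeakFreePath X →₀ k) →ₗ[k]
      (ValleyPeakFreePath X →₀ k) :=
    Finsupp.linearCombination k fun m => Finsupp.linearCombination k fun m' => g m m'
  have h : mul.compr₂ (peakFreeInclusion k X) =
      (diamondMul lam).compl₁₂ (peakFreeInclusion k X) (peakFreeInclusion k X) := by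
    ext m m' : 4
    simp [mul, hg]
  exact ⟨mul, fun a b => LinearMap.congr_fun₂ h a b⟩

theorem peakFreeInclusion_raise (x : ValleyPeakFreePath X →₀ k) :
    peakFreeInclusion k X (peakFreeRaiseOp k X x) = raiseOp k X (peakFreeInclusion k X x) := by
  simp only [peakFreeInclusion, peakFreeRaiseOp, raiseOp, Finsupp.lmapDomain_apply,
    ← Finsupp.mapDomain_comp]
  rfl

theorem peakFreeRaiseOp_single (n : ValleyPeakFreePath X) :
    peakFreeRaiseOp k X (Finsupp.single n 1) =
      Finsupp.single ⟨n.1.raise, n.2.1.raise, n.2.2.raise⟩ 1 := by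
  simp [peakFreeRaiseOp]

section Unitization

variable {R : Type w} [NonUnitalRing R] [Module k R]

/-- The extension of an operator on a nonunitary algebra to its unitization by `0` on the scalars.
It satisfies the Rota-Baxter identity only on elements without scalar part. -/
def unitizationOp (Q : R →ₗ[k] R) : Unitization k R →ₗ[k] Unitization k R :=
  Unitization.inrHom k k R ∘ₗ Q ∘ₗ Unitization.sndHom k k R

@[simp] theorem unitizationOp_inr (Q : R →ₗ[k] R) (x : R) :
    unitizationOp Q (Unitization.inr x : Unitization k R) = Unitization.inr (Q x) := rfl

theorem unitizationOp_mul {Q : R →ₗ[k] R} (hQ : IsRotaBaxterOperator lam Q) (x y : R) :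
    unitizationOp Q (Unitization.inr x : Unitization k R) * unitizationOp Q (Unitization.inr y) =
      unitizationOp Q (Unitization.inr x * unitizationOp Q (Unitization.inr y)) +
      unitizationOp Q (unitizationOp Q (Unitization.inr x) * Unitization.inr y) +
      lam • unitizationOp Q (Unitization.inr x * Unitization.inr y) := by
  simp only [unitizationOp_inr, ← Unitization.inr_mul, hQ x y, Unitization.inr_add,
    Unitization.inr_smul]

variable [IsScalarTower k R R] [SMulCommClass k R R]

/-- Scalars appear only in the value of the trivial path. -/
theorem exists_inr_eq_evalHom (Q : R →ₗ[k] R) (f : X → R) {m : MotzkinPath X} (hm : m ≠ 1) :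
    ∃ x : R, evalHom (unitizationOp Q) (fun x => (Unitization.inr (f x) : Unitization k R)) m =
      Unitization.inr x := by
  suffices h : (evalHom (unitizationOp Q)
      (fun x => (Unitization.inr (f x) : Unitization k R)) m).fst = 0 from
    ⟨_, Unitization.ext (by simpa using h) rfl⟩
  rcases m.eq_one_or_level_mul_or_startsUp with rfl | ⟨x, r, rfl⟩ | h
  · exact absurd rfl hm
  · simp
  · obtain ⟨n, r, rfl⟩ := m.exists_raise_mul h
    simp [unitizationOp]

end Unitization

/-- Paths are evaluated in the unitization of the target; the values of nontrivial paths lie in the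
target itself. -/
theorem isFreeNonunitaryRotaBaxterAlgebra_of_peakFreeInclusion
    {mul : (ValleyPeakFreePath X →₀ k) →ₗ[k] (ValleyPeakFreePath X →₀ k) →ₗ[k]
      (ValleyPeakFreePath X →₀ k)}
    (hmul : ∀ a b, peakFreeInclusion k X (mul a b) =
      diamondMul lam (peakFreeInclusion k X a) (peakFreeInclusion k X b)) :
    IsFreeNonunitaryRotaBaxterAlgebra.{u, v, w, max u v} lam mul
      (peakFreeRaiseOp k X) (peakFreeLevelMap k) where
  isNonunitaryRotaBaxterAlgebra :=
    { assoc := fun a b c => peakFreeInclusion_injective (by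
        simp only [hmul, diamondMul_assoc])
      rotaBaxter := fun a b => peakFreeInclusion_injective (by
        simp only [map_add, map_smul, hmul, peakFreeInclusion_raise]
        exact diamondMul_raiseOp_raiseOp lam _ _) }
  existsUnique_lift R _ _ _ _ Q hQ f := by
    -- The unit of the unitization serves as the value of the trivial path.
    let E := evalHom (unitizationOp Q) fun x => (Unitization.inr (f x) : Unitization k R)
    let Φ := evalAlgHom (unitizationOp Q) fun x => (Unitization.inr (f x) : Unitization k R)
    let φ : (ValleyPeakFreePath X →₀ k) →ₗ[k] R := Unitization.sndHom k k R ∘ₗ Φ.toLinearMap ∘ₗ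
      toPathAlgebra k X ∘ₗ peakFreeInclusion k X
    have hφ : ∀ a, (Unitization.inr (φ a) : Unitization k R) =
        Φ (toPathAlgebra k X (peakFreeInclusion k X a)) := by
      refine LinearMap.congr_fun (f := Unitization.inrHom k k R ∘ₗ φ)
        (g := Φ.toLinearMap ∘ₗ toPathAlgebra k X ∘ₗ peakFreeInclusion k X) ?_
      ext m : 2
      obtain ⟨x, hx⟩ := exists_inr_eq_evalHom Q f m.2.2.1
      simp only [φ, Φ, LinearMap.comp_apply, Finsupp.lsingle_apply, peakFreeInclusion_single,
        toPathAlgebra_single, AlgHom.toLinearMap_apply, evalAlgHom_of, hx]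
      rfl
    have hE : ∀ m : ValleyPeakFreePath X,
        (Unitization.inr (φ (Finsupp.single m 1)) : Unitization k R) = E m.1 := fun m => by
      rw [hφ, peakFreeInclusion_single, toPathAlgebra_single]
      exact evalAlgHom_of _ _ _
    refine ⟨φ, ⟨?_, ?_, ?_⟩, ?_⟩
    -- Multiplicativity: inside a raised factor of a peak-free path there is a nontrivial path,
    -- whose value has no scalar part, so that the Rota-Baxter identity of `Q` applies.
    · suffices h : mul.compr₂ φ = (LinearMap.mul k R).compl₁₂ φ φ from
        fun a b => LinearMap.congr_fun₂ h a b
      ext m m' : 4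
      apply Unitization.inr_injective (R := k)
      simp only [LinearMap.comp_apply, Finsupp.lsingle_apply, LinearMap.compr₂_apply,
        LinearMap.compl₁₂_apply, LinearMap.mul_apply', Unitization.inr_mul, hE]
      rw [hφ, hmul, peakFreeInclusion_single, peakFreeInclusion_single, diamondMul_single_single,
        toPathAlgebra_diamond]
      refine evalAlgHom_diamond _ _ lam NoPeak (fun _ _ h => h.of_mul_left)
        (fun _ _ h => h.of_mul_right) (fun _ h => h.peakFree_of_raise.noPeak) ?_ m.1 m'.1
        m.2.2.noPeak m'.2.2.noPeak
      intro n n' hn hn'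
      obtain ⟨x, hx⟩ := exists_inr_eq_evalHom Q f hn.peakFree_of_raise.1
      obtain ⟨y, hy⟩ := exists_inr_eq_evalHom Q f hn'.peakFree_of_raise.1
      rw [hx, hy]
      exact unitizationOp_mul lam hQ x y
    · intro a
      apply Unitization.inr_injective (R := k)
      rw [hφ, peakFreeInclusion_raise, toPathAlgebra_raiseOp, evalAlgHom_raiseLinear, ← hφ,
        unitizationOp_inr]
    · intro x
      apply Unitization.inr_injective (R := k)
      rw [peakFreeLevelMap, hE]
      exact evalHom_level _ _ x
    · rintro ψ ⟨h_mul, h_raise, h_level⟩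
      have mul_single : ∀ (m m' : ValleyPeakFreePath X) (h : (m.1 * m'.1).ValleyFree),
          mul (Finsupp.single m 1) (Finsupp.single m' 1) =
            Finsupp.single ⟨m.1 * m'.1, h, m.2.2.mul m'.2.2⟩ 1 := by
        intro m m' h
        apply peakFreeInclusion_injective
        rw [hmul, peakFreeInclusion_single, peakFreeInclusion_single, peakFreeInclusion_single,
          diamondMul_single_of_not lam h.not_endsDown_and_startsUp]
      ext m : 2
      obtain ⟨m, hm⟩ := m
      apply Unitization.inr_injective (R := k)
      simp only [LinearMap.comp_apply, Finsupp.lsingle_apply, hE]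
      induction m using factor_induction with
      | one => exact absurd rfl hm.2.1
      | level_mul x r ih =>
        have hx : (Unitization.inr (ψ (peakFreeLevelMap k x)) : Unitization k R) = E (level x) := by
          rw [h_level]
          exact (evalHom_level (unitizationOp Q)
            (fun x => (Unitization.inr (f x) : Unitization k R)) x).symm
        by_cases hr1 : r = 1
        · subst hr1
          simp only [mul_one]
          exact hx
        have hr : r.ValleyFree ∧ r.PeakFree :=
          ⟨hm.1.of_mul_right, hr1, hm.2.noPeak.of_mul_right⟩
        rw [map_mul, ← hx, ← ih hr, ← Unitization.inr_mul, ← h_mul, peakFreeLevelMap,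
          mul_single _ _ hm.1]
      | raise_mul n r ihn ihr =>
        have hn : n.ValleyFree ∧ n.PeakFree :=
          ⟨hm.1.of_mul_left.of_raise, hm.2.noPeak.of_mul_left.peakFree_of_raise⟩
        have hx : (Unitization.inr (ψ (peakFreeRaiseOp k X (Finsupp.single ⟨n, hn⟩ 1))) :
            Unitization k R) = E n.raise := by
          rw [h_raise, ← unitizationOp_inr, ihn hn]
          exact (evalHom_raise (unitizationOp Q)
            (fun x => (Unitization.inr (f x) : Unitization k R)) n).symm
        rw [peakFreeRaiseOp_single] at hx
        by_cases hr1 : r = 1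
        · subst hr1
          simp only [mul_one]
          exact hx
        have hr : r.ValleyFree ∧ r.PeakFree :=
          ⟨hm.1.of_mul_right, hr1, hm.2.noPeak.of_mul_right⟩
        rw [map_mul, ← hx, ← ihr hr, ← Unitization.inr_mul, ← h_mul, mul_single _ _ hm.1]

end FreeNonunitary

theorem corollary6p3 {k : Type u} [CommRing k] (lam : k) (X : Type v) :
    (IsDiamondProduct lam (diamondMul lam : (ValleyFreePath X →₀ k) →ₗ[k] _) ∧
      ∀ mul : (ValleyFreePath X →₀ k) →ₗ[k] (ValleyFreePath X →₀ k) →ₗ[k] (ValleyFreePath X →₀ k),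
        IsDiamondProduct lam mul → mul = diamondMul lam) ∧
    IsFreeRotaBaxterAlgebra.{u, v, w, max u v} lam (diamondMul lam)
      (Finsupp.single ValleyFreePath.trivialPath 1) (raiseOp k X) (levelMap k) ∧
    ∃ mul : (ValleyPeakFreePath X →₀ k) →ₗ[k] (ValleyPeakFreePath X →₀ k) →ₗ[k]
        (ValleyPeakFreePath X →₀ k),
      (∀ a b, peakFreeInclusion k X (mul a b) =
        diamondMul lam (peakFreeInclusion k X a) (peakFreeInclusion k X b)) ∧
      IsFreeNonunitaryRotaBaxterAlgebra.{u, v, w, max u v} lam mul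
        (peakFreeRaiseOp k X) (peakFreeLevelMap k) := by
  obtain ⟨mul, hmul⟩ := exists_peakFree_mul (X := X) lam
  exact ⟨⟨isDiamondProduct_diamondMul lam, fun _ h => h.eq_diamondMul⟩,
    isFreeRotaBaxterAlgebra_diamondMul lam, mul, hmul,
    isFreeNonunitaryRotaBaxterAlgebra_of_peakFreeInclusion lam hmul⟩
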